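/- **Setting.** Let $G=(L\cup R,E)$ be a finite bipartite graph with $n=|L|+|R|$ vertices, let $\mathsf N_w$ be the neighbourhood of a vertex $w$, and let $\mathsf C_v\ge 1$ ($v\in R$) be integer capacities. The arboricity $\lambda$ of $G$ is the least number of forests into which $E$ can be partitioned. A *fractional allocation* is a function $x:E\to[0,1]$ with $\sum_{v\in \mathsf N_u}x_{u,v}\le 1$ for all $u\in L$ and $\sum_{u\in \mathsf N_v}x_{u,v}\le \mathsf C_v$ for all $v\in R$; its weight is $\sum_{e\in E}x_e$. A fractional allocation is *$\alpha$-approximate* if every fractional allocation weighs at most $\alpha$ times as much as it does. **Sampled algorithm.** Its parameters are $\epsilon\in(0,\frac14]$, a number of rounds $\tau$, a phase length $B\ge 1$, and a sample size $t\ge(1+\epsilon)^{2B}\epsilon^{-5}\log n$ ($B$, $t$, $\tau$ natural numbers, $\log$ the natural logarithm). Initially $\beta_v=1$ for $v\in R$ and $\beta_u=\sum_{v\in \mathsf N_u}\beta_v$ for $u\in L$. The $\tau$ rounds are split into consecutive phases of $B$ rounds (the last one may be shorter). At the start of each phase, every vertex $w$ partitions $\mathsf N_w$ into the groups $\mathsf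 N_w\cap\mathcal L_x$, $x\in\mathbb Z$, of those neighbours $a$ whose current value satisfies $\beta_a\in((1+\epsilon)^{x-1},(1+\epsilon)^x]$. For each round of the phase, each vertex $w$ and each of its nonempty groups, $t$ elements $S_{w,x,1},\dots,S_{w,x,t}$ of the group are drawn independently and uniformly at random (with replacement, independently for different rounds, vertices and groups). In each round: 1. every $u\in L$ sets $\beta_u\leftarrow\sum_x \frac{|\mathsf N_u\cap\mathcal L_x|}{t}\sum_{i=1}^t\beta_{S_{u,x,i}}$; 2. every $v\in R$ computes $\overline{\mathsf{alloc}}_v=\sum_x\frac{|\mathsf N_v\cap\mathcal L_x|}{t}\sum_{i=1}^t \beta_v/\beta_{S_{v,x,i}}$, and replaces $\beta_v$ by $\beta_v(1+\epsilon)$ if $\overline{\mathsf{alloc}}_v\le \mathsf C_v/(1+\epsilon)$, by $\beta_v/(1+\epsilon)$ if $\overline{\mathsf{alloc}}_v\ge \mathsf C_v(1+\epsilon)$, and leaves it unchanged otherwise. Let $\beta_v$ ($v\in R$) now denote the values at the beginning of round $\tau$, and put $x_{u,v}=\beta_v/\sum_{v'\in \mathsf N_u}\beta_{v'}$ and $\mathsf{alloc}_v=\sum_{u\in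 \mathsf N_v}x_{u,v}$. The output is $x'_{u,v}=\frac{\mathsf C_v}{\mathsf{alloc}_v}x_{u,v}$ if $\mathsf{alloc}_v>\mathsf C_v$, and $x'_{u,v}=x_{u,v}$ otherwise. **Theorem.** If $0<\epsilon\le\frac14$ and $\tau\ge\log_{1+\epsilon}(4\lambda/\epsilon)+1$ (for a graph without edges: $\tau\ge 1$), then with probability at least $1-\tau\,(4\epsilon/n)^{6}$ (in particular, at least $1-n^{-5}$ whenever $\tau\le n$) the output is a $(2+16\epsilon)$-approximate fractional allocation. -/

import Mathlib

noncomputable section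

/-- The arboricity of a graph: the least number of forests into which its edges can be
partitioned. -/
def arboricity {V : Type*} (G : SimpleGraph V) : ℕ :=
  sInf {k : ℕ | ∃ c : G.edgeSet → Fin k, ∀ i : Fin k,
    (SimpleGraph.fromEdgeSet (Subtype.val '' (c ⁻¹' {i}))).IsAcyclic}

namespace Alloc

section Instance

variable {L R : Type*} [Fintype L] [Fintype R]

open scoped Classical in
/-- The neighbourhood of a left vertex. -/
def nbrL (G : SimpleGraph (L ⊕ R)) (u : L) : Finset R :=
  Finset.univ.filter fun v => G.Adj (Sum.inl u) (Sum.inr v)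

open scoped Classical in
/-- The neighbourhood of a right vertex. -/
def nbrR (G : SimpleGraph (L ⊕ R)) (v : R) : Finset L :=
  Finset.univ.filter fun u => G.Adj (Sum.inl u) (Sum.inr v)

/-- `x` is a fractional allocation of the instance `(G, C)`; only the values of `x` on edges
of `G` matter. -/
def IsFractionalAllocation (G : SimpleGraph (L ⊕ R)) (C : R → ℕ) (x : L → R → ℝ) : Prop :=
  (∀ u v, G.Adj (Sum.inl u) (Sum.inr v) → 0 ≤ x u v ∧ x u v ≤ 1) ∧
  (∀ u, ∑ v ∈ nbrL G u, x u v ≤ 1) ∧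
  (∀ v, ∑ u ∈ nbrR G v, x u v ≤ (C v : ℝ))

/-- The weight of `x`, the sum of its values over all edges. -/
def weight (G : SimpleGraph (L ⊕ R)) (x : L → R → ℝ) : ℝ :=
  ∑ u, ∑ v ∈ nbrL G u, x u v

/-- `x` is an `α`-approximate fractional allocation: it is a fractional allocation, and every
fractional allocation weighs at most `α` times as much as `x`. -/
def IsApproxFractionalAllocation (G : SimpleGraph (L ⊕ R)) (C : R → ℕ) (α : ℝ)
    (x : L → R → ℝ) : Prop :=
  IsFractionalAllocation G C x ∧
    ∀ y, IsFractionalAllocation G C y → weight G y ≤ α * weight G x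

/-- The value `β_v / ∑_{v' ∈ N_u} β_{v'}` that a left vertex `u` assigns to its edge to `v`. -/
def proportional (G : SimpleGraph (L ⊕ R)) (β : R → ℝ) (u : L) (v : R) : ℝ :=
  β v / ∑ v' ∈ nbrL G u, β v'

/-- The total value that the proportional assignment gives to a right vertex. -/
def alloc (G : SimpleGraph (L ⊕ R)) (β : R → ℝ) (v : R) : ℝ :=
  ∑ u ∈ nbrR G v, proportional G β u v

/-- The proportional assignment, scaled down at each over-allocated right vertex. -/
def scaled (G : SimpleGraph (L ⊕ R)) (C : R → ℕ) (β : R → ℝ) (u : L) (v : R) : ℝ :=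
  if (C v : ℝ) < alloc G β v then (C v : ℝ) / alloc G β v * proportional G β u v
  else proportional G β u v

end Instance

section Sampling

/-- The index `x` of the interval `((1 + ε) ^ (x - 1), (1 + ε) ^ x]` that contains `b`. -/
def level (ε b : ℝ) : ℤ := ⌈Real.logb (1 + ε) b⌉

theorem level_eq_iff {ε b : ℝ} (hε : 0 < ε) (hb : 0 < b) (x : ℤ) :
    level ε b = x ↔ (1 + ε) ^ (x - 1) < b ∧ b ≤ (1 + ε) ^ x := by
  have h1 : (1 : ℝ) < 1 + ε := by linarith
  unfold level
  rw [Int.ceil_eq_iff, Real.lt_logb_iff_rpow_lt h1 hb, Real.logb_le_iff_le_rpow h1 hb,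
    Real.rpow_intCast, show ((x : ℝ) - 1) = ((x - 1 : ℤ) : ℝ) by push_cast; ring,
    Real.rpow_intCast]

variable {A D : Type*}

open scoped Classical in
/-- The levels that occur among the neighbours of `w`. -/
def levels (nbr : A → Finset D) (lev : D → ℤ) (w : A) : Finset ℤ := (nbr w).image lev

open scoped Classical in
/-- The group of the neighbours of `w` that have level `x`. -/
def group (nbr : A → Finset D) (lev : D → ℤ) (w : A) (x : ℤ) : Finset D :=
  (nbr w).filter fun a => lev a = x

theorem group_nonempty (nbr : A → Finset D) (lev : D → ℤ) (w : A)
    (x : ↥(levels nbr lev w)) : (group nbr lev w x).Nonempty := by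
  obtain ⟨x, hx⟩ := x
  obtain ⟨a, ha, rfl⟩ := Finset.mem_image.1 hx
  exact ⟨a, Finset.mem_filter.2 ⟨ha, rfl⟩⟩

/-- All the samples drawn on one side of the graph for one round: for each vertex `w` and each
of its (nonempty) groups, a sequence of `t` elements of that group. The uniform distribution on
this type makes all of them independent, each uniform on its group (with replacement). -/
abbrev Samples (nbr : A → Finset D) (lev : D → ℤ) (t : ℕ) : Type _ :=
  ∀ w : A, ∀ x : ↥(levels nbr lev w), Fin t → ↥(group nbr lev w x)

instance (nbr : A → Finset D) (lev : D → ℤ) (t : ℕ) : Nonempty (Samples nbr lev t) :=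
  ⟨fun w x _ => ⟨_, (group_nonempty nbr lev w x).choose_spec⟩⟩

open scoped Classical in
instance [Fintype A] (nbr : A → Finset D) (lev : D → ℤ) (t : ℕ) : Fintype (Samples nbr lev t) :=
  inferInstance

/-- The estimate of `∑_{a ∈ N_w} f a` from the samples: in each group, the sum over the `t`
samples is rescaled by (size of the group) / `t`. -/
def estimate {nbr : A → Finset D} {lev : D → ℤ} {t : ℕ} (S : Samples nbr lev t)
    (f : D → ℝ) (w : A) : ℝ :=
  ∑ x : ↥(levels nbr lev w),
    ((group nbr lev w x).card : ℝ) / (t : ℝ) * ∑ i : Fin t, f (S w x i)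

end Sampling

section Algorithm

variable {L R : Type*} [Fintype L] [Fintype R]

/-- The state of the sampled algorithm between two rounds. -/
structure State (L R : Type*) where
  /-- the current priorities `β_v` of the right vertices -/
  betaR : R → ℝ
  /-- the current values `β_u` of the left vertices -/
  betaL : L → ℝ
  /-- the levels of the right vertices at the start of the current phase -/
  levR : R → ℤ
  /-- the levels of the left vertices at the start of the current phase -/
  levL : L → ℤ
  /-- the priorities with which the most recent round was started -/
  lastR : R → ℝ

/-- Initially `β_v = 1` on the right, and `β_u = ∑_{v ∈ N_u} β_v` on the left. The other entries
are overwritten in the first round. -/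
def initial (G : SimpleGraph (L ⊕ R)) : State L R where
  betaR _ := 1
  betaL u := ∑ _v ∈ nbrL G u, 1
  levR _ := 0
  levL _ := 0
  lastR _ := 1

/-- The start of a phase: the vertices are grouped anew according to their current values. -/
def regroup (ε : ℝ) (s : State L R) : State L R :=
  { s with
    levR := fun v => level ε (s.betaR v)
    levL := fun u => level ε (s.betaL u) }

/-- The multiplicative update of a priority `b`, given an estimate `a` of the allocated amount
and the capacity `c`. -/
def updatePriority (ε b a c : ℝ) : ℝ :=
  if a ≤ c / (1 + ε) then b * (1 + ε) else if c * (1 + ε) ≤ a then b / (1 + ε) else b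

/-- One round. Every left vertex estimates the sum of the priorities of its neighbours, every
right vertex then estimates the amount allocated to it and updates its priority. The samples of
the two sides are independent of each other and of everything before; they are taken from the
groups formed at the start of the phase. -/
def oneRound (G : SimpleGraph (L ⊕ R)) (C : R → ℕ) (ε : ℝ) (t : ℕ) (s : State L R) :
    PMF (State L R) :=
  (PMF.uniformOfFintype (Samples (nbrL G) s.levR t)).bind fun S =>
    (PMF.uniformOfFintype (Samples (nbrR G) s.levL t)).map fun T =>
      { betaL := fun u => estimate S s.betaR u
        betaR := fun v =>
          updatePriority ε (s.betaR v)
            (estimate T (fun u => s.betaR v / estimate S s.betaR u) v) (C v)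
        levR := s.levR
        levL := s.levL
        lastR := s.betaR }

/-- The distribution of the state after the given number of rounds, in phases of `B` rounds. -/
def run (G : SimpleGraph (L ⊕ R)) (C : R → ℕ) (ε : ℝ) (B t : ℕ) : ℕ → PMF (State L R)
  | 0 => PMF.pure (initial G)
  | r + 1 => (run G C ε B t r).bind fun s =>
      oneRound G C ε t (if r % B = 0 then regroup ε s else s)

/-- The distribution of the output after `τ` rounds: the assignment that is proportional to the
priorities at the beginning of the last round, scaled down to the capacities. -/
def sampledAllocation (G : SimpleGraph (L ⊕ R)) (C : R → ℕ) (ε : ℝ) (B t τ : ℕ) :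
    PMF (L → R → ℝ) :=
  (run G C ε B t τ).map fun s => scaled G C s.lastR

end Algorithm

end Alloc

end

/-!
Let `k = 1 + ε`, and let `r = τ - 1` be the number of rounds before the last one.

**Structure of the priorities.** Suppose that in every round the right vertices know their
allocated amounts up to a factor `ρ`. Changing all priorities by factors in `[1 / k, k]` never
lowers the amount allocated to a vertex whose priority was increased, and never raises it where the
priority was decreased (`mul_alloc_le`). Hence, looking at the last round in which the priority of
`v` was not increased, either `β_v = k ^ r`, or `v` is almost saturated, that is
`C_v ≤ A * alloc_v` with `A = 1 + 7 ε ≥ k ^ 2 * ρ`; dually, either `β_v = k ^ (-r)`, or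
`alloc_v ≤ A * C_v` (`updatePriority_cases`, `Balanced`).

**Approximation.** Let `T` and `Z` be the right vertices with priority `k ^ r` and `k ^ (-r)`, and
let `N(T)` be the set of the neighbours of `T`. A fractional allocation weighs at most `|N(T)|` plus
the capacity outside of `T`, and the latter is at most `A` times the weight of the output. The
vertices in `N(T)` distribute `|N(T)|` in total. What arrives outside of `Z` is again at most `A`
times the weight of the output, and along each edge to `Z` goes at most `k ^ (-2 r)`. There are at
most `λ (|N(T)| + |Z|)` such edges, since a forest has fewer edges than vertices
(`card_edges_between_le`), so that these are negligible when `k ^ r ≥ 4 λ / ε`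
(`isApproxFractionalAllocation_scaled`).

**Sampling.** During a phase, the elements of a group keep values that differ by a factor of at most
about `k ^ (2 B)`: on the right because priorities change by at most `k` in each round, on the left
because the sums of priorities do so and the estimates are close to the sums (`Accurate`). A
Chernoff bound (`card_sum_deviation_le`) makes all left estimates accurate up to `1 ± 3 ε / 4` and
all right ones up to `1 ± 5 ε / 4`, with a failure probability per group of at most
`2 * exp (- 9 log n / (4 ε) ^ 3)`. There are at most `n ^ 2 / 2` groups, so a round fails with
probability at most `(4 ε / n) ^ 6` (`toOuterMeasure_oneRound_le`), and induction over the rounds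
(`toOuterMeasure_run_le`) finishes the proof.
-/

/-! ### Edge counts and arboricity -/

theorem SimpleGraph.IsAcyclic.card_edgeSet_le {V : Type*} [Finite V] {F : SimpleGraph V}
    (hF : F.IsAcyclic) : Nat.card F.edgeSet ≤ Nat.card V := by
  classical
  have := Fintype.ofFinite V
  rcases isEmpty_or_nonempty V with hV | hV
  · have : IsEmpty F.edgeSet := ⟨fun ⟨e, _⟩ => by
      induction e with
      | _ x y => exact hV.false x⟩
    simp
  · obtain ⟨T, hFT, -, hT⟩ :=
      (SimpleGraph.connected_top (V := V)).exists_isTree_le_of_le_of_isAcyclic le_top hF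
    have h1 := hT.card_edgeFinset
    have h2 : Nat.card F.edgeSet ≤ Nat.card T.edgeSet :=
      Nat.card_mono (Set.toFinite _) (SimpleGraph.edgeSet_mono hFT)
    rw [SimpleGraph.edgeFinset, Set.toFinset_card] at h1
    simp only [Nat.card_eq_fintype_card] at h2 ⊢
    omega

theorem SimpleGraph.isAcyclic_fromEdgeSet_of_subsingleton {V : Type*} {s : Set (Sym2 V)}
    (hs : s.Subsingleton) : (SimpleGraph.fromEdgeSet s).IsAcyclic := by
  intro v w hw
  have hsub : ∀ e ∈ w.edges, e ∈ s := fun e he => by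
    have := w.edges_subset_edgeSet he
    rw [SimpleGraph.edgeSet_fromEdgeSet] at this
    exact this.1
  have h3 := hw.three_le_length
  rw [← SimpleGraph.Walk.length_edges] at h3
  have h0 := hsub _ (List.getElem_mem (by omega : 0 < w.edges.length))
  have h1 := hsub _ (List.getElem_mem (by omega : 1 < w.edges.length))
  have := (hw.edges_nodup.getElem_inj_iff).1 (hs h0 h1)
  omega

/-- The infimum that defines the arboricity of a finite graph is attained. -/
theorem exists_forest_partition {V : Type*} [Finite V] (G : SimpleGraph V) :
    ∃ c : G.edgeSet → Fin (arboricity G), ∀ i,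
      (SimpleGraph.fromEdgeSet (Subtype.val '' (c ⁻¹' {i}))).IsAcyclic := by
  classical
  refine Nat.sInf_mem (s := {k : ℕ | ∃ c : G.edgeSet → Fin k, ∀ i : Fin k,
    (SimpleGraph.fromEdgeSet (Subtype.val '' (c ⁻¹' {i}))).IsAcyclic}) ?_
  have := Fintype.ofFinite G.edgeSet
  refine ⟨Fintype.card G.edgeSet, Fintype.equivFin G.edgeSet, fun i => ?_⟩
  refine SimpleGraph.isAcyclic_fromEdgeSet_of_subsingleton (Set.Subsingleton.image ?_ _)
  intro x hx y hy
  exact (Fintype.equivFin G.edgeSet).injective (hx.trans hy.symm)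

theorem arboricity_pos {V : Type*} [Finite V] {G : SimpleGraph V} {a b : V} (h : G.Adj a b) :
    0 < arboricity G := by
  obtain ⟨c, -⟩ := exists_forest_partition G
  exact Fin.pos (c ⟨s(a, b), h⟩)

namespace Alloc

open scoped Classical in
/-- The number of edges between a set of left vertices and a set of right vertices is at most the
arboricity times the number of these vertices, as it is in each forest. -/
theorem card_edges_between_le {L R : Type*} [Fintype L] [Fintype R] (G : SimpleGraph (L ⊕ R))
    (X : Finset L) (Y : Finset R) :
    ((X ×ˢ Y).filter fun p => G.Adj (Sum.inl p.1) (Sum.inr p.2)).card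
      ≤ arboricity G * (X.card + Y.card) := by
  obtain ⟨c, hc⟩ := exists_forest_partition G
  set P := (X ×ˢ Y).filter fun p => G.Adj (Sum.inl p.1) (Sum.inr p.2) with hP
  have hPX : ∀ p ∈ P, (p.1 ∈ X ∧ p.2 ∈ Y) ∧ G.Adj (Sum.inl p.1) (Sum.inr p.2) := fun p hp => by
    simpa [hP] using hp
  let col : P → Fin (arboricity G) := fun p => c ⟨s(Sum.inl p.1.1, Sum.inr p.1.2), (hPX _ p.2).2⟩
  have hcol : ∀ i, (Finset.univ.filter fun p => col p = i).card ≤ X.card + Y.card := by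
    intro i
    let F := SimpleGraph.fromEdgeSet (Subtype.val '' (c ⁻¹' {i}))
    let W : Set (L ⊕ R) := ↑(X.disjSum Y)
    have hF : (F.induce W).IsAcyclic := (hc i).induce W
    have hle := hF.card_edgeSet_le
    have hW : Nat.card W = X.card + Y.card := by
      simp [W, Finset.card_disjSum]
    rw [hW] at hle
    refine le_trans ?_ hle
    rw [← Fintype.card_subtype, ← Nat.card_eq_fintype_card]
    let φ : {p : P // col p = i} → (F.induce W).edgeSet := fun p =>
      ⟨s(⟨Sum.inl p.1.1.1, by simpa [W] using (hPX _ p.1.2).1.1⟩,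
        ⟨Sum.inr p.1.1.2, by simpa [W] using (hPX _ p.1.2).1.2⟩), by
        rw [SimpleGraph.mem_edgeSet, SimpleGraph.induce_adj, SimpleGraph.fromEdgeSet_adj]
        exact ⟨⟨_, p.2, rfl⟩, by simp⟩⟩
    refine Nat.card_le_card_of_injective φ ?_
    rintro ⟨⟨⟨u, v⟩, hp⟩, hi⟩ ⟨⟨⟨u', v'⟩, hp'⟩, hi'⟩ h
    simpa [φ] using h
  calc P.card = (Finset.univ : Finset P).card := by simp
    _ = ∑ i, (Finset.univ.filter fun p => col p = i).card :=
        Finset.card_eq_sum_card_fiberwise (fun _ _ => Finset.mem_coe.2 (Finset.mem_univ _))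
    _ ≤ ∑ _i : Fin (arboricity G), (X.card + Y.card) := Finset.sum_le_sum fun i _ => hcol i
    _ = _ := by simp

end Alloc

/-! ### Proportional assignments and their scaled versions -/

namespace Alloc

section Allocation

variable {L R : Type*} {G : SimpleGraph (L ⊕ R)}

theorem mem_nbrL [Fintype R] {u : L} {v : R} : v ∈ nbrL G u ↔ G.Adj (Sum.inl u) (Sum.inr v) := by
  simp [nbrL]

theorem mem_nbrR [Fintype L] {u : L} {v : R} : u ∈ nbrR G v ↔ G.Adj (Sum.inl u) (Sum.inr v) := by
  simp [nbrR]

variable [Fintype R]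

theorem sum_priorities_pos {β : R → ℝ} (hβ : ∀ v, 0 < β v) {u : L} (hu : (nbrL G u).Nonempty) :
    0 < ∑ v ∈ nbrL G u, β v :=
  Finset.sum_pos (fun v _ => hβ v) hu

theorem proportional_nonneg {β : R → ℝ} (hβ : ∀ v, 0 < β v) (u : L) (v : R) :
    0 ≤ proportional G β u v :=
  div_nonneg (hβ v).le (Finset.sum_nonneg fun v _ => (hβ v).le)

theorem sum_proportional {β : R → ℝ} (hβ : ∀ v, 0 < β v) {u : L} (hu : (nbrL G u).Nonempty) :
    ∑ v ∈ nbrL G u, proportional G β u v = 1 := by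
  unfold proportional
  rw [← Finset.sum_div, div_self (sum_priorities_pos hβ hu).ne']

variable [Fintype L]

theorem sum_nbrL_eq_sum_nbrR (G : SimpleGraph (L ⊕ R)) (f : L → R → ℝ) :
    ∑ u, ∑ v ∈ nbrL G u, f u v = ∑ v, ∑ u ∈ nbrR G v, f u v :=
  Finset.sum_comm' fun u v => by simp [mem_nbrL, mem_nbrR]

theorem alloc_nonneg {β : R → ℝ} (hβ : ∀ v, 0 < β v) (v : R) : 0 ≤ alloc G β v :=
  Finset.sum_nonneg fun u _ => proportional_nonneg hβ u v

theorem scaled_nonneg {β : R → ℝ} (hβ : ∀ v, 0 < β v) (C : R → ℕ) (u : L) (v : R) :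
    0 ≤ scaled G C β u v := by
  unfold scaled
  split_ifs
  · exact mul_nonneg (div_nonneg (Nat.cast_nonneg _) (alloc_nonneg hβ v))
      (proportional_nonneg hβ u v)
  · exact proportional_nonneg hβ u v

theorem scaled_le_proportional {β : R → ℝ} (hβ : ∀ v, 0 < β v) (C : R → ℕ) (u : L) (v : R) :
    scaled G C β u v ≤ proportional G β u v := by
  unfold scaled
  split_ifs with h
  · exact mul_le_of_le_one_left (proportional_nonneg hβ u v)
      (div_le_one_of_le₀ h.le (alloc_nonneg hβ v))
  · exact le_rfl

theorem sum_scaled (β : R → ℝ) (C : R → ℕ) (v : R) :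
    ∑ u ∈ nbrR G v, scaled G C β u v = min (alloc G β v) (C v) := by
  unfold scaled
  split_ifs with h
  · have : alloc G β v ≠ 0 := ((Nat.cast_nonneg (C v)).trans_lt h).ne'
    rw [← Finset.mul_sum, min_eq_right h.le]
    exact div_mul_cancel₀ _ this
  · exact (min_eq_left (not_lt.1 h)).symm

theorem weight_scaled (β : R → ℝ) (C : R → ℕ) :
    weight G (scaled G C β) = ∑ v, min (alloc G β v) (C v) := by
  unfold weight
  rw [sum_nbrL_eq_sum_nbrR]
  exact Finset.sum_congr rfl fun v _ => sum_scaled β C v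

theorem isFractionalAllocation_scaled {β : R → ℝ} (hβ : ∀ v, 0 < β v) (C : R → ℕ) :
    IsFractionalAllocation G C (scaled G C β) := by
  have hsum : ∀ u, ∑ v ∈ nbrL G u, scaled G C β u v ≤ 1 := by
    intro u
    rcases (nbrL G u).eq_empty_or_nonempty with hu | hu
    · simp [hu]
    · exact (Finset.sum_le_sum fun v _ => scaled_le_proportional hβ C u v).trans
        (sum_proportional hβ hu).le
  refine ⟨fun u v huv => ⟨scaled_nonneg hβ C u v, ?_⟩, hsum, fun v => ?_⟩
  · exact (Finset.single_le_sum (fun v _ => scaled_nonneg hβ C u v) (mem_nbrL.2 huv)).trans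
      (hsum u)
  · rw [sum_scaled]
    exact min_le_right _ _

open scoped Classical in
/-- The left vertices that have a neighbour in `T`. -/
noncomputable def leftNbrs (G : SimpleGraph (L ⊕ R)) (T : Finset R) : Finset L :=
  Finset.univ.filter fun u => ∃ v ∈ nbrL G u, v ∈ T

open scoped Classical in
/-- Each left vertex next to `T` contributes at most one to any fractional allocation, and all the
other edges end in a right vertex outside of `T`. -/
theorem weight_le_card_leftNbrs_add {C : R → ℕ} {y : L → R → ℝ}
    (hy : IsFractionalAllocation G C y) (T : Finset R) :
    weight G y ≤ (leftNbrs G T).card + ∑ v, if v ∈ T then 0 else (C v : ℝ) := by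
  have h0 : ∀ u, ∀ v ∈ nbrL G u, 0 ≤ y u v := fun u v h => (hy.1 u v (mem_nbrL.1 h)).1
  have h1 : ∀ u, ∑ v ∈ nbrL G u, y u v ≤
      (if u ∈ leftNbrs G T then 1 else 0) + ∑ v ∈ nbrL G u, if v ∈ T then 0 else y u v := by
    intro u
    have h2 : 0 ≤ ∑ v ∈ nbrL G u, if v ∈ T then 0 else y u v :=
      Finset.sum_nonneg fun v hv => by
        split_ifs
        · exact le_rfl
        · exact h0 u v hv
    split_ifs with hu
    · linarith [hy.2.1 u]
    · rw [zero_add]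
      refine Finset.sum_le_sum fun v hv => ?_
      rw [if_neg fun hv' => hu (by simpa [leftNbrs] using ⟨v, hv, hv'⟩)]
  calc weight G y ≤ ∑ u, ((if u ∈ leftNbrs G T then 1 else 0) +
        ∑ v ∈ nbrL G u, if v ∈ T then 0 else y u v) := Finset.sum_le_sum fun u _ => h1 u
    _ = (leftNbrs G T).card + ∑ v, ∑ u ∈ nbrR G v, if v ∈ T then 0 else y u v := by
        rw [Finset.sum_add_distrib, sum_nbrL_eq_sum_nbrR]
        simp
    _ ≤ _ := by
        gcongr with v
        split_ifs
        · simp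
        · exact hy.2.2 v

open scoped Classical in
/-- A left vertex next to `T` assigns a total of one. At most `q` of this goes along each edge to
`Z`, and the number of these edges is bounded through the arboricity. -/
theorem card_leftNbrs_le {β : R → ℝ} (hβ : ∀ v, 0 < β v) (T Z : Finset R) {q : ℝ} (hq : 0 ≤ q)
    (hTZ : ∀ v ∈ T, ∀ v' ∈ Z, β v' ≤ q * β v) :
    ((leftNbrs G T).card : ℝ) ≤
      q * (arboricity G * ((leftNbrs G T).card + Z.card)) +
        ∑ v, if v ∈ Z then 0 else alloc G β v := by
  have hx : ∀ u ∈ leftNbrs G T, ∀ v ∈ Z, proportional G β u v ≤ q := by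
    intro u hu v hv
    obtain ⟨v', hv', hT⟩ : ∃ v ∈ nbrL G u, v ∈ T := by simpa [leftNbrs] using hu
    have hle : β v' ≤ ∑ w ∈ nbrL G u, β w :=
      Finset.single_le_sum (fun w _ => (hβ w).le) hv'
    exact (div_le_iff₀ ((hβ v').trans_le hle)).2
      ((hTZ v' hT v hv).trans (mul_le_mul_of_nonneg_left hle hq))
  have h1 : ∀ u ∈ leftNbrs G T, (1 : ℝ) ≤ (∑ v ∈ Z, if G.Adj (.inl u) (.inr v) then q else 0) +
      ∑ v ∈ nbrL G u, if v ∈ Z then 0 else proportional G β u v := by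
    intro u hu
    have hne : (nbrL G u).Nonempty := by
      obtain ⟨v', hv', -⟩ : ∃ v ∈ nbrL G u, v ∈ T := by simpa [leftNbrs] using hu
      exact ⟨v', hv'⟩
    have h2 : (∑ v ∈ Z, if G.Adj (.inl u) (.inr v) then q else 0) =
        ∑ v ∈ nbrL G u, if v ∈ Z then q else 0 := by
      rw [← Finset.sum_filter, ← Finset.sum_filter]
      refine Finset.sum_congr ?_ fun _ _ => rfl
      ext v
      simp [mem_nbrL, and_comm]
    rw [← sum_proportional hβ hne, h2, ← Finset.sum_add_distrib]
    refine Finset.sum_le_sum fun v hv => ?_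
    split_ifs with hZ
    · simpa using hx u hu v hZ
    · simp
  have hcard : ∑ u ∈ leftNbrs G T, ∑ v ∈ Z, (if G.Adj (.inl u) (.inr v) then q else 0) ≤
      q * (arboricity G * ((leftNbrs G T).card + Z.card)) := by
    rw [← Finset.sum_product', ← Finset.sum_filter, Finset.sum_const, nsmul_eq_mul, mul_comm]
    refine mul_le_mul_of_nonneg_left ?_ hq
    exact_mod_cast card_edges_between_le G (leftNbrs G T) Z
  calc ((leftNbrs G T).card : ℝ) = ∑ u ∈ leftNbrs G T, (1 : ℝ) := by simp
    _ ≤ _ := Finset.sum_le_sum h1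
    _ = _ := Finset.sum_add_distrib
    _ ≤ _ := by
        refine add_le_add hcard ?_
        calc _ ≤ ∑ u, ∑ v ∈ nbrL G u, (if v ∈ Z then 0 else proportional G β u v) := by
              refine Finset.sum_le_sum_of_subset_of_nonneg (Finset.subset_univ _) fun u _ _ =>
                Finset.sum_nonneg fun v _ => ?_
              split_ifs
              · exact le_rfl
              · exact proportional_nonneg hβ u v
          _ = _ := by
              rw [sum_nbrL_eq_sum_nbrR]
              refine Finset.sum_congr rfl fun v _ => ?_
              split_ifs
              · simp
              · rfl

/-- The approximation guarantee. Vertices outside of `T` are almost saturated, vertices outside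
of `Z` are hardly over-allocated, and the priorities in `Z` are negligible against those
in `T`. -/
theorem isApproxFractionalAllocation_scaled {C : R → ℕ} (hC : ∀ v, 1 ≤ C v) {β : R → ℝ}
    (hβ : ∀ v, 0 < β v) {T Z : Finset R} (hdisj : Disjoint T Z) {q A η α : ℝ} (hq : 0 ≤ q)
    (hA : 1 ≤ A) (hTZ : ∀ v ∈ T, ∀ v' ∈ Z, β v' ≤ q * β v)
    (hT : ∀ v ∉ T, (C v : ℝ) ≤ A * alloc G β v) (hZ : ∀ v ∉ Z, alloc G β v ≤ A * C v)
    (hη : q * arboricity G ≤ η) (hη1 : η < 1) (hα : 2 * A ≤ α * (1 - η)) :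
    IsApproxFractionalAllocation G C α (scaled G C β) := by
  classical
  refine ⟨isFractionalAllocation_scaled hβ C, fun y hy => ?_⟩
  have hW := weight_scaled (G := G) β C
  set W := weight G (scaled G C β)
  have hm : ∀ v, 0 ≤ min (alloc G β v) (C v) := fun v =>
    le_min (alloc_nonneg hβ v) (Nat.cast_nonneg _)
  have hW0 : 0 ≤ W := hW ▸ Finset.sum_nonneg fun v _ => hm v
  have hCT : ∀ v ∉ T, (C v : ℝ) ≤ A * min (alloc G β v) (C v) := fun v hv => by
    rw [mul_min_of_nonneg _ _ (by linarith)]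
    exact le_min (hT v hv) (le_mul_of_one_le_left (Nat.cast_nonneg _) hA)
  have h1 : (∑ v, if v ∈ T then 0 else (C v : ℝ)) ≤ A * W := by
    rw [hW, Finset.mul_sum]
    refine Finset.sum_le_sum fun v _ => ?_
    split_ifs with h
    · exact mul_nonneg (by linarith) (hm v)
    · exact hCT v h
  have h2 : (∑ v, if v ∈ Z then 0 else alloc G β v) ≤ A * W := by
    rw [hW, Finset.mul_sum]
    refine Finset.sum_le_sum fun v _ => ?_
    split_ifs with h
    · exact mul_nonneg (by linarith) (hm v)
    · rw [mul_min_of_nonneg _ _ (by linarith)]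
      exact le_min (le_mul_of_one_le_left (alloc_nonneg hβ v) hA) (hZ v h)
  have h3 : (Z.card : ℝ) ≤ A * W := by
    calc (Z.card : ℝ) = ∑ v ∈ Z, (1 : ℝ) := by simp
      _ ≤ ∑ v ∈ Z, A * min (alloc G β v) (C v) := Finset.sum_le_sum fun v hv => by
          have : (1 : ℝ) ≤ C v := by exact_mod_cast hC v
          exact this.trans (hCT v fun h => Finset.disjoint_left.1 hdisj h hv)
      _ ≤ ∑ v, A * min (alloc G β v) (C v) :=
          Finset.sum_le_sum_of_subset_of_nonneg (Finset.subset_univ _) fun v _ _ =>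
            mul_nonneg (by linarith) (hm v)
      _ = A * W := by rw [hW, Finset.mul_sum]
  have h4 := weight_le_card_leftNbrs_add hy T
  have h5 := card_leftNbrs_le (G := G) hβ T Z hq hTZ
  set N : ℝ := ((leftNbrs G T).card : ℝ) with hN
  have hN0 : 0 ≤ N := Nat.cast_nonneg _
  have h6 : q * (arboricity G * (N + Z.card)) ≤ η * (N + A * W) := by
    rw [← mul_assoc]
    have hz : (0 : ℝ) ≤ (Z.card : ℝ) := Nat.cast_nonneg _
    have hη0 : 0 ≤ η := le_trans (by positivity) hη
    exact mul_le_mul hη (by linarith) (by positivity) hη0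
  have h7 : weight G y * (1 - η) ≤ 2 * A * W := by
    have h8 : weight G y * (1 - η) ≤ (N + A * W) * (1 - η) :=
      mul_le_mul_of_nonneg_right (by linarith) (by linarith)
    nlinarith
  have h9 := mul_le_mul_of_nonneg_right hα hW0
  refine le_of_mul_le_mul_right (a := 1 - η) ?_ (by linarith)
  linarith

end Allocation

end Alloc

/-! ### Concentration of sample sums -/

namespace Alloc

section Concentration

/-- Markov's inequality for the exponential moment of a sum of `t` independent samples. -/
theorem card_exp_le_card_mul {D : Type*} [Fintype D] (t : ℕ) (g : D → ℝ) (a : ℝ) (m : ℝ)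
    (P : (Fin t → D) → Prop) [DecidablePred P]
    (hP : ∀ ω, P ω → a ≤ ∑ i, g (ω i))
    (hm : ∑ d, Real.exp (g d) ≤ Fintype.card D * Real.exp m) :
    ((Finset.univ.filter P).card : ℝ) ≤
      Real.exp (t * m - a) * Fintype.card (Fin t → D) := by
  classical
  have h1 : ∑ ω : Fin t → D, Real.exp (∑ i, g (ω i)) = (∑ d, Real.exp (g d)) ^ t := by
    simp only [Real.exp_sum]
    exact (Fintype.sum_pow (fun d => Real.exp (g d)) t).symm
  have h2 : ((Finset.univ.filter P).card : ℝ) * Real.exp a ≤ (∑ d, Real.exp (g d)) ^ t := by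
    rw [← h1, ← nsmul_eq_mul, ← Finset.sum_const]
    calc _ ≤ ∑ ω ∈ Finset.univ.filter P, Real.exp (∑ i, g (ω i)) :=
          Finset.sum_le_sum fun ω hω => Real.exp_le_exp.2 (hP ω (by simpa using hω))
      _ ≤ _ := Finset.sum_le_sum_of_subset_of_nonneg (Finset.subset_univ _)
          fun _ _ _ => (Real.exp_pos _).le
  have h3 : (∑ d, Real.exp (g d)) ^ t ≤ (Fintype.card D * Real.exp m) ^ t :=
    pow_le_pow_left₀ (Finset.sum_nonneg fun _ _ => (Real.exp_pos _).le) hm t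
  rw [mul_pow, ← Real.exp_nat_mul] at h3
  have h4 := h2.trans h3
  rw [Real.exp_sub, div_mul_eq_mul_div, le_div_iff₀ (Real.exp_pos a)]
  simpa [mul_comm] using h4

/-- The exponential moment of a function with values in `[0, M]`, by convexity of `exp`. -/
theorem sum_exp_le {D : Type*} [Fintype D] [Nonempty D] {f : D → ℝ} {M : ℝ} (hM : 0 < M)
    (hf0 : ∀ d, 0 ≤ f d) (hfM : ∀ d, f d ≤ M) (θ : ℝ) :
    ∑ d, Real.exp (θ * f d / M) ≤
      Fintype.card D *
        Real.exp ((∑ d, f d) / Fintype.card D / M * (Real.exp θ - 1)) := by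
  have hcard : (0 : ℝ) < Fintype.card D := by exact_mod_cast Fintype.card_pos
  have h1 : ∀ d, Real.exp (θ * f d / M) ≤ 1 + f d / M * (Real.exp θ - 1) := by
    intro d
    have hs0 : 0 ≤ f d / M := div_nonneg (hf0 d) hM.le
    have hs1 : f d / M ≤ 1 := (div_le_one hM).2 (hfM d)
    have := convexOn_exp.2 (Set.mem_univ 0) (Set.mem_univ θ) (sub_nonneg.2 hs1) hs0 (by ring)
    simp only [smul_eq_mul, mul_zero, zero_add, Real.exp_zero, mul_one] at this
    rw [show θ * f d / M = f d / M * θ by ring]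
    linarith
  calc ∑ d, Real.exp (θ * f d / M) ≤ ∑ d, (1 + f d / M * (Real.exp θ - 1)) :=
        Finset.sum_le_sum fun d _ => h1 d
    _ = Fintype.card D * ((∑ d, f d) / Fintype.card D / M * (Real.exp θ - 1) + 1) := by
        rw [Finset.sum_add_distrib, ← Finset.sum_mul, ← Finset.sum_div]
        simp only [Finset.sum_const, Finset.card_univ, nsmul_eq_mul, mul_one]
        field_simp
        ring
    _ ≤ _ := mul_le_mul_of_nonneg_left (Real.add_one_le_exp _) hcard.le

open scoped Classical in
/-- A two-sided Chernoff bound: the sum of `t` independent uniform samples of a positive function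
whose values differ by a factor of at most `κ`, as a count of the exceptional sample sequences. -/
theorem card_sum_deviation_le {D : Type*} [Fintype D] [Nonempty D] {f : D → ℝ} {κ δ : ℝ}
    (hf : ∀ d, 0 < f d) (hκ : ∀ d d', f d ≤ κ * f d') (hδ0 : 0 ≤ δ) (hδ1 : δ ≤ 1) (t : ℕ) :
    ((Finset.univ.filter fun ω : Fin t → D =>
        ¬ |∑ i, f (ω i) - t * ((∑ d, f d) / Fintype.card D)| ≤
          δ * (t * ((∑ d, f d) / Fintype.card D))).card : ℝ) ≤
      2 * Real.exp (-(δ ^ 2 * t / (4 * κ))) * Fintype.card (Fin t → D) := by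
  set μ : ℝ := (∑ d, f d) / Fintype.card D with hμ
  obtain ⟨d₀, hd₀⟩ := Finite.exists_max f
  set M := f d₀
  have hM : 0 < M := hf d₀
  have hκ0 : 0 < κ := pos_of_mul_pos_left (hM.trans_le (hκ d₀ d₀)) hM.le
  have hcard : (0 : ℝ) < Fintype.card D := by exact_mod_cast Fintype.card_pos
  have hμM : 1 / κ ≤ μ / M := by
    rw [div_le_div_iff₀ hκ0 hM, hμ, div_mul_eq_mul_div, le_div_iff₀ hcard, one_mul,
      Finset.sum_mul]
    calc M * Fintype.card D = ∑ _d : D, M := by simp [mul_comm]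
      _ ≤ _ := Finset.sum_le_sum fun d _ => by rw [mul_comm]; exact hκ d₀ d
  -- With `θ = ± δ / 2`, the exponent is `t μ / M` times `exp θ - 1 - θ - |θ| δ ≤ θ² - |θ| δ`.
  have key : ∀ s : ℝ, |s| = 1 → ∀ P : (Fin t → D) → Prop,
      (∀ ω, P ω → δ * (t * μ) ≤ s * (∑ i, f (ω i) - t * μ)) →
      ((Finset.univ.filter P).card : ℝ) ≤
        Real.exp (-(δ ^ 2 * t / (4 * κ))) * Fintype.card (Fin t → D) := by
    intro s hs P hP
    have hss : s * s = 1 := by rw [← abs_mul_abs_self, hs, one_mul]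
    have h1 := card_exp_le_card_mul t (fun d => (s * (δ / 2)) * f d / M)
      ((δ / 2 * δ + s * (δ / 2)) * (t * μ) / M) _ P (fun ω hω => by
        rw [← Finset.sum_div, ← Finset.mul_sum]
        refine div_le_div_of_nonneg_right ?_ hM.le
        have := mul_le_mul_of_nonneg_left (hP ω hω) (by linarith : 0 ≤ δ / 2)
        linarith)
      (sum_exp_le hM (fun d => (hf d).le) hd₀ (s * (δ / 2)))
    refine h1.trans (mul_le_mul_of_nonneg_right (Real.exp_le_exp.2 ?_) (Nat.cast_nonneg _))
    have habs : |s * (δ / 2)| ≤ 1 := by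
      rw [abs_mul, hs, one_mul, abs_of_nonneg (by linarith)]
      linarith
    have h2 := (abs_le.1 (Real.abs_exp_sub_one_sub_id_le habs)).2
    have h3 : (s * (δ / 2)) ^ 2 = δ ^ 2 / 4 := by
      rw [mul_pow, pow_two s, hss]
      ring
    rw [h3] at h2
    have h4 : t * (μ / M * (Real.exp (s * (δ / 2)) - 1)) -
        (δ / 2 * δ + s * (δ / 2)) * (t * μ) / M =
        (t * (μ / M)) * (Real.exp (s * (δ / 2)) - 1 - s * (δ / 2) - δ ^ 2 / 2) := by
      ring
    rw [← hμ, h4]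
    have ht : (0 : ℝ) ≤ t := Nat.cast_nonneg _
    have hμM0 : 0 ≤ μ / M := le_trans (by positivity) hμM
    calc _ ≤ (t * (μ / M)) * (-(δ ^ 2 / 4)) :=
          mul_le_mul_of_nonneg_left (by linarith) (mul_nonneg ht hμM0)
      _ = -((t * (δ ^ 2 / 4)) * (μ / M)) := by ring
      _ ≤ -((t * (δ ^ 2 / 4)) * (1 / κ)) :=
          neg_le_neg (mul_le_mul_of_nonneg_left hμM (by positivity))
      _ = _ := by field_simp
  set P₁ : (Fin t → D) → Prop := fun ω => δ * (t * μ) ≤ 1 * (∑ i, f (ω i) - t * μ)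
  set P₂ : (Fin t → D) → Prop := fun ω => δ * (t * μ) ≤ (-1) * (∑ i, f (ω i) - t * μ)
  have hsub : (Finset.univ.filter fun ω : Fin t → D =>
      ¬ |∑ i, f (ω i) - t * μ| ≤ δ * (t * μ)) ⊆
      Finset.univ.filter P₁ ∪ Finset.univ.filter P₂ := by
    intro ω hω
    have h := (Finset.mem_filter.1 hω).2
    rw [not_le, lt_abs] at h
    rw [Finset.mem_union, Finset.mem_filter, Finset.mem_filter]
    rcases h with h | h
    · exact Or.inl ⟨Finset.mem_univ _, by simp only [P₁]; linarith⟩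
    · exact Or.inr ⟨Finset.mem_univ _, by simp only [P₂]; linarith⟩
  have h5 : ((Finset.univ.filter fun ω : Fin t → D =>
      ¬ |∑ i, f (ω i) - t * μ| ≤ δ * (t * μ)).card : ℝ) ≤
      (Finset.univ.filter P₁).card + (Finset.univ.filter P₂).card := by
    exact_mod_cast (Finset.card_le_card hsub).trans (Finset.card_union_le _ _)
  have h6 := key 1 (by simp) P₁ fun _ h => h
  have h7 := key (-1) (by simp) P₂ fun _ h => h
  linarith

open scoped Classical in
/-- Under the uniform distribution on a product, each coordinate is uniformly distributed. -/
theorem card_filter_apply_mul_card {ι : Type*} [Fintype ι] {β : ι → Type*}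
    [∀ i, Fintype (β i)] (i : ι) (P : β i → Prop) :
    (Finset.univ.filter fun f : ∀ i, β i => P (f i)).card * Fintype.card (β i) =
      (Finset.univ.filter P).card * Fintype.card (∀ i, β i) := by
  have h1 : Fintype.card (∀ i, β i) =
      Fintype.card (β i) * Fintype.card (∀ j : {j // j ≠ i}, β j) := by
    rw [← Fintype.card_prod]
    exact Fintype.card_congr (Equiv.piSplitAt i β)
  have h2 : (Finset.univ.filter fun f : ∀ i, β i => P (f i)).card =
      (Finset.univ.filter P).card * Fintype.card (∀ j : {j // j ≠ i}, β j) := by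
    rw [← Fintype.card_subtype, ← Fintype.card_subtype, ← Fintype.card_prod]
    refine Fintype.card_congr
      (((Equiv.piSplitAt i β).subtypeEquiv (q := fun p => P p.1) fun f => Iff.rfl).trans
        ⟨fun p => (⟨p.1.1, p.2⟩, p.1.2), fun p => ⟨(p.1.1, p.2), p.1.2⟩, fun _ => rfl,
          fun _ => rfl⟩)
  rw [h1, h2]
  ring

end Concentration

end Alloc

/-! ### The sampled estimates -/

namespace Alloc

section Estimates

open scoped Classical in
theorem toOuterMeasure_uniformOfFintype_le {α : Type*} [Fintype α] [Nonempty α] (P : α → Prop)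
    {c : ℝ} (hP : ((Finset.univ.filter P).card : ℝ) ≤ c * Fintype.card α) :
    (PMF.uniformOfFintype α).toOuterMeasure {a | P a} ≤ ENNReal.ofReal c := by
  have hcard : (0 : ℝ) < Fintype.card α := by exact_mod_cast Fintype.card_pos
  rw [PMF.toOuterMeasure_uniformOfFintype_apply]
  refine ENNReal.div_le_of_le_mul ?_
  rw [← ENNReal.ofReal_natCast (Fintype.card α), ← ENNReal.ofReal_mul' hcard.le,
    ← ENNReal.ofReal_natCast]
  refine ENNReal.ofReal_le_ofReal (le_trans (le_of_eq ?_) hP)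
  rw [← Fintype.card_subtype]
  rfl

/-- The coordinates of a uniformly distributed element of a product are uniformly distributed. -/
theorem toOuterMeasure_uniformOfFintype_pi {ι : Type*} [Fintype ι] {β : ι → Type*}
    [∀ i, Fintype (β i)] [∀ i, Nonempty (β i)] {hS : Fintype (∀ i, β i)} (i : ι)
    (P : β i → Prop) :
    (PMF.uniformOfFintype (∀ i, β i)).toOuterMeasure {f | P (f i)} =
      (PMF.uniformOfFintype (β i)).toOuterMeasure {b | P b} := by
  classical
  have h := card_filter_apply_mul_card i P
  rw [PMF.toOuterMeasure_uniformOfFintype_apply, PMF.toOuterMeasure_uniformOfFintype_apply,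
    ENNReal.div_eq_div_iff (by simp) (by simp) (by simp) (by simp)]
  have h1 : Fintype.card ↑{f : ∀ i, β i | P (f i)} =
      (Finset.univ.filter fun f : ∀ i, β i => P (f i)).card := by
    rw [← Fintype.card_subtype]
    exact Fintype.card_congr (Equiv.refl _)
  have h2 : Fintype.card ↑{b | P b} = (Finset.univ.filter P).card := by
    rw [← Fintype.card_subtype]
    rfl
  rw [h1, h2, mul_comm]
  convert congrArg (Nat.cast : ℕ → ENNReal) h using 1
  · push_cast
    congr!
  · push_cast
    rw [mul_comm]
    congr!

variable {A D : Type*} {nbr : A → Finset D} {lev : D → ℤ} {t : ℕ}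

theorem sum_levels_sum_group (f : D → ℝ) (w : A) :
    ∑ x : levels nbr lev w, ∑ d : group nbr lev w x, f d = ∑ a ∈ nbr w, f a := by
  classical
  calc _ = ∑ x : levels nbr lev w, ∑ d ∈ group nbr lev w x, f d :=
        Finset.sum_congr rfl fun x _ => Finset.sum_coe_sort _ f
    _ = ∑ x ∈ levels nbr lev w, ∑ d ∈ group nbr lev w x, f d :=
        Finset.sum_coe_sort (levels nbr lev w) fun x => ∑ d ∈ group nbr lev w x, f d
    _ = _ := by
        have := Finset.sum_fiberwise_of_maps_to (s := nbr w) (t := levels nbr lev w) (g := lev)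
          (fun a ha => Finset.mem_image_of_mem lev ha) f
        rw [← this]
        refine Finset.sum_congr rfl fun x _ => Finset.sum_congr ?_ fun _ _ => rfl
        ext
        simp [group]

/-- If in each group the samples of `w` are representative up to a factor of `1 ± δ`, then so is
the estimate. -/
theorem abs_estimate_sub_le (ht : 0 < t) (S : Samples nbr lev t) (f : D → ℝ) (w : A) {δ : ℝ}
    (h : ∀ x : levels nbr lev w,
      |∑ i, f (S w x i) -
          t * ((∑ d : group nbr lev w x, f d) / Fintype.card (group nbr lev w x))| ≤
        δ * (t * ((∑ d : group nbr lev w x, f d) / Fintype.card (group nbr lev w x)))) :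
    |estimate S f w - ∑ a ∈ nbr w, f a| ≤ δ * ∑ a ∈ nbr w, f a := by
  have ht' : (0 : ℝ) < t := by exact_mod_cast ht
  rw [← sum_levels_sum_group (lev := lev) f w, estimate, ← Finset.sum_sub_distrib, Finset.mul_sum]
  refine (Finset.abs_sum_le_sum_abs _ _).trans (Finset.sum_le_sum fun x _ => ?_)
  have hc : (0 : ℝ) < (group nbr lev w x).card := by
    exact_mod_cast (group_nonempty nbr lev w x).card_pos
  have hx := h x
  rw [Fintype.card_coe] at hx
  have h1 : ((group nbr lev w x).card : ℝ) / t * ∑ i, f (S w x i) -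
      ∑ d : group nbr lev w x, f d =
      (group nbr lev w x).card / t * (∑ i, f (S w x i) -
        t * ((∑ d : group nbr lev w x, f d) / (group nbr lev w x).card)) := by
    field_simp
  rw [h1, abs_mul, abs_of_nonneg (by positivity)]
  calc _ ≤ _ := mul_le_mul_of_nonneg_left hx (by positivity)
    _ = _ := by field_simp

/-- All the estimates of one side are within a factor of `1 ± δ` with high probability, if the
estimated function varies by a factor of at most `κ` in each group. -/
theorem toOuterMeasure_estimate_le [Fintype A] [Fintype D] (ht : 0 < t) (f : A → D → ℝ) {κ δ : ℝ}
    (hf : ∀ w, ∀ a ∈ nbr w, 0 < f w a)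
    (hκ : ∀ w, ∀ a ∈ nbr w, ∀ a' ∈ nbr w, lev a = lev a' → f w a ≤ κ * f w a')
    (hδ0 : 0 ≤ δ) (hδ1 : δ ≤ 1) :
    (PMF.uniformOfFintype (Samples nbr lev t)).toOuterMeasure
        {S | ¬ ∀ w, |estimate S (f w) w - ∑ a ∈ nbr w, f w a| ≤ δ * ∑ a ∈ nbr w, f w a} ≤
      ENNReal.ofReal
        (Fintype.card A * Fintype.card D * (2 * Real.exp (-(δ ^ 2 * t / (4 * κ))))) := by
  classical
  set c := 2 * Real.exp (-(δ ^ 2 * t / (4 * κ))) with hc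
  let good (w : A) (x : levels nbr lev w) (ω : Fin t → group nbr lev w x) : Prop :=
    |∑ i, f w (ω i) -
        t * ((∑ d : group nbr lev w x, f w d) / Fintype.card (group nbr lev w x))| ≤
      δ * (t * ((∑ d : group nbr lev w x, f w d) / Fintype.card (group nbr lev w x)))
  have hne : ∀ w (x : levels nbr lev w), Nonempty (group nbr lev w x) := fun w x =>
    (group_nonempty nbr lev w x).to_subtype
  have hbad : ∀ w x, (PMF.uniformOfFintype (Samples nbr lev t)).toOuterMeasure
      {S | ¬ good w x (S w x)} ≤ ENNReal.ofReal c := by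
    intro w x
    have := hne w
    have h1 := toOuterMeasure_uniformOfFintype_pi
      (β := fun w => ∀ x : levels nbr lev w, Fin t → group nbr lev w x)
      (hS := inferInstanceAs (Fintype (Samples nbr lev t))) w fun S => ¬ good w x (S x)
    have h2 := toOuterMeasure_uniformOfFintype_pi
      (β := fun x : levels nbr lev w => Fin t → group nbr lev w x) (hS := inferInstance)
      x fun ω => ¬ good w x ω
    refine (h1.trans h2).trans_le ?_
    refine toOuterMeasure_uniformOfFintype_le _ ?_
    have h := card_sum_deviation_le (f := fun d : group nbr lev w x => f w d) (κ := κ) (fun d => ?_)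
      (fun d d' => ?_) hδ0 hδ1 t
    · convert! h
    · exact hf w d (Finset.mem_filter.1 d.2).1
    · have h1 := Finset.mem_filter.1 d.2
      have h2 := Finset.mem_filter.1 d'.2
      exact hκ w d h1.1 d' h2.1 (h1.2.trans h2.2.symm)
  have hsub : {S : Samples nbr lev t |
      ¬ ∀ w, |estimate S (f w) w - ∑ a ∈ nbr w, f w a| ≤ δ * ∑ a ∈ nbr w, f w a} ⊆
      ⋃ p : Σ w, levels nbr lev w, {S | ¬ good p.1 p.2 (S p.1 p.2)} := by
    intro S hS
    by_contra hcon
    refine hS fun w => abs_estimate_sub_le ht S (f w) w fun x => ?_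
    by_contra hx
    exact hcon (Set.mem_iUnion.2 ⟨⟨w, x⟩, hx⟩)
  have hcard : (Fintype.card (Σ w, levels nbr lev w) : ℝ) ≤ Fintype.card A * Fintype.card D := by
    have h1 : ∀ w, (levels nbr lev w).card ≤ Fintype.card D := fun w =>
      Finset.card_image_le.trans (Finset.card_le_univ _)
    rw [Fintype.card_sigma]
    simp only [Fintype.card_coe]
    have := Finset.sum_le_sum fun w (_ : w ∈ Finset.univ) => h1 w
    rw [Finset.sum_const, smul_eq_mul, Finset.card_univ] at this
    exact_mod_cast this
  have hc0 : 0 ≤ c := by positivity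
  calc _ ≤ _ := MeasureTheory.measure_mono hsub
    _ ≤ ∑ p : Σ w, levels nbr lev w, (PMF.uniformOfFintype (Samples nbr lev t)).toOuterMeasure
          {S | ¬ good p.1 p.2 (S p.1 p.2)} := MeasureTheory.measure_iUnion_fintype_le _ _
    _ ≤ ∑ _p : Σ w, levels nbr lev w, ENNReal.ofReal c :=
        Finset.sum_le_sum fun p _ => hbad p.1 p.2
    _ = ENNReal.ofReal (Fintype.card (Σ w, levels nbr lev w) * c) := by
        rw [Finset.sum_const, nsmul_eq_mul, Finset.card_univ,
          ENNReal.ofReal_mul (Nat.cast_nonneg _), ENNReal.ofReal_natCast]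
    _ ≤ _ := ENNReal.ofReal_le_ofReal (mul_le_mul_of_nonneg_right hcard hc0)

end Estimates

end Alloc

/-! ### The effect of one round -/

namespace Alloc

section Round

variable {L R : Type*}

theorem updatePriority_bounds {ε b : ℝ} (hε : 0 < ε) (hb : 0 < b) (a c : ℝ) :
    0 < updatePriority ε b a c ∧ updatePriority ε b a c ≤ (1 + ε) * b ∧
      b ≤ (1 + ε) * updatePriority ε b a c := by
  unfold updatePriority
  have h0 : 0 < ε * b := mul_pos hε hb
  have h1 : 0 < ε * (ε * b) := mul_pos hε h0
  have h2 : (1 + ε) * (b / (1 + ε)) = b := mul_div_cancel₀ b (by linarith)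
  split_ifs
  · exact ⟨by nlinarith, by linarith, by nlinarith⟩
  · exact ⟨by positivity, (div_le_self hb.le (by linarith)).trans (by nlinarith), h2.ge⟩
  · exact ⟨hb, by nlinarith, by nlinarith⟩

/-- If all priorities change by a factor of at most `k`, then so does the ratio between the
allocated amount and the priority of a vertex. -/
theorem mul_alloc_le [Fintype L] [Fintype R] (G : SimpleGraph (L ⊕ R)) {k : ℝ} {β β' : R → ℝ}
    (hβ : ∀ v, 0 < β v) (hβ' : ∀ v, 0 < β' v) (h : ∀ v, β v ≤ k * β' v) (v : R) :
    β v * alloc G β' v ≤ k * β' v * alloc G β v := by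
  unfold alloc
  rw [Finset.mul_sum, Finset.mul_sum]
  refine Finset.sum_le_sum fun u hu => ?_
  have hne : (nbrL G u).Nonempty := ⟨v, mem_nbrL.2 (mem_nbrR.1 hu)⟩
  have h1 := sum_priorities_pos hβ hne
  have h2 := sum_priorities_pos hβ' hne
  have h3 : ∑ w ∈ nbrL G u, β w ≤ k * ∑ w ∈ nbrL G u, β' w := by
    rw [Finset.mul_sum]
    exact Finset.sum_le_sum fun w _ => h w
  unfold proportional
  rw [mul_div_assoc', mul_div_assoc', div_le_div_iff₀ h2 h1]
  have := mul_le_mul_of_nonneg_left h3 (mul_pos (hβ v) (hβ' v)).le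
  linarith

/-- The case analysis for one update. A priority that is not increased belongs to a vertex which
is almost saturated, also after the round, and an increased priority does not lower the allocated
amount. The same holds with the directions reversed. Here `al` and `al'` are the allocated amounts
before and after the round, and `a` is an estimate of `al` up to a factor of `ρ`. -/
theorem updatePriority_cases {ε b a c al al' ρ A : ℝ} (hε : 0 < ε) (hb : 0 < b)
    (hal' : 0 ≤ al') (hc : 0 ≤ c) (hρ : 1 ≤ ρ) (hA : (1 + ε) ^ 2 * ρ ≤ A)
    (h₁ : b * al' ≤ (1 + ε) * updatePriority ε b a c * al)
    (h₂ : updatePriority ε b a c * al ≤ (1 + ε) * b * al')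
    (h₃ : al ≤ ρ * a) (h₄ : a ≤ ρ * al) :
    (updatePriority ε b a c = b * (1 + ε) ∧ al ≤ al' ∨ c ≤ A * al') ∧
      (updatePriority ε b a c = b / (1 + ε) ∧ al' ≤ al ∨ al' ≤ A * c) := by
  have hk : 0 < 1 + ε := by linarith
  have hρ0 : 0 ≤ ρ := by linarith
  revert h₁ h₂
  unfold updatePriority
  split_ifs with ha ha'
  -- The priority increases: the estimate is low, and `al'` is at most `(1 + ε) ^ 2 * al`.
  · intro h₁ h₂
    have e₁ : al' ≤ (1 + ε) ^ 2 * al := le_of_mul_le_mul_left (by linarith) hb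
    have e₂ : al ≤ al' := le_of_mul_le_mul_left (by linarith) (mul_pos hb hk)
    refine ⟨Or.inl ⟨rfl, e₂⟩, Or.inr ?_⟩
    have e₃ : c / (1 + ε) ≤ c := div_le_self hc (by linarith)
    calc al' ≤ (1 + ε) ^ 2 * (ρ * c) := e₁.trans (by gcongr; exact h₃.trans (by gcongr; linarith))
      _ = (1 + ε) ^ 2 * ρ * c := by ring
      _ ≤ A * c := by gcongr
  · intro h₁ h₂
    rw [mul_div_cancel₀ _ hk.ne'] at h₁
    rw [div_mul_eq_mul_div, div_le_iff₀ hk] at h₂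
    have e₁ : al' ≤ al := le_of_mul_le_mul_left h₁ hb
    have e₂ : al ≤ (1 + ε) ^ 2 * al' := le_of_mul_le_mul_left (by linarith) hb
    refine ⟨Or.inr ?_, Or.inl ⟨rfl, e₁⟩⟩
    calc c ≤ c * (1 + ε) := by nlinarith
      _ ≤ ρ * ((1 + ε) ^ 2 * al') := (ha'.trans h₄).trans (by gcongr)
      _ = (1 + ε) ^ 2 * ρ * al' := by ring
      _ ≤ A * al' := by gcongr
  · intro h₁ h₂
    have e₁ : al' ≤ (1 + ε) * al := le_of_mul_le_mul_left (by linarith) hb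
    have e₂ : al ≤ (1 + ε) * al' := le_of_mul_le_mul_left (by linarith) hb
    rw [not_le] at ha ha'
    rw [div_lt_iff₀ hk] at ha
    refine ⟨Or.inr ?_, Or.inr ?_⟩
    · calc c ≤ (ρ * ((1 + ε) * al')) * (1 + ε) :=
            ha.le.trans (by gcongr; exact h₄.trans (by gcongr))
        _ = (1 + ε) ^ 2 * ρ * al' := by ring
        _ ≤ A * al' := by gcongr
    · calc al' ≤ (1 + ε) * (ρ * (c * (1 + ε))) :=
            e₁.trans (by gcongr; exact h₃.trans (by gcongr))
        _ = (1 + ε) ^ 2 * ρ * c := by ring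
        _ ≤ A * c := by gcongr

/-- Estimates with relative errors `3 ε / 4` on the left and `5 ε / 4` on the right cost a factor
that fits into the approximation ratio. -/
theorem sq_mul_ratio_le {ε : ℝ} (hε : 0 < ε) (hε' : ε ≤ 1 / 4) :
    (1 + ε) ^ 2 * ((1 + 3 / 4 * ε) / (1 - 5 / 4 * ε)) ≤ 1 + 7 * ε := by
  rw [mul_div_assoc', div_le_iff₀ (by linarith)]
  nlinarith [mul_pos hε hε, mul_pos hε (mul_pos hε hε), mul_nonneg hε.le (sub_nonneg.2 hε'),
    mul_nonneg (mul_pos hε hε).le (sub_nonneg.2 hε')]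

variable [Fintype L] [Fintype R] {G : SimpleGraph (L ⊕ R)} {C : R → ℕ} {ε : ℝ}

/-- What holds after `r` rounds with good samples: every right vertex whose priority was not
increased in all rounds is almost saturated, every one whose priority was not decreased in all
rounds is hardly over-allocated, and the values on the left are almost current. -/
structure Balanced (G : SimpleGraph (L ⊕ R)) (C : R → ℕ) (ε : ℝ) (r : ℕ) (s : State L R) :
    Prop where
  pos : ∀ v, 0 < s.betaR v
  saturated : ∀ v, s.betaR v = (1 + ε) ^ r ∨ (C v : ℝ) ≤ (1 + 7 * ε) * alloc G s.betaR v
  bounded : ∀ v, s.betaR v = ((1 + ε) ^ r)⁻¹ ∨ alloc G s.betaR v ≤ (1 + 7 * ε) * C v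
  left : ∀ u, (nbrL G u).Nonempty →
    (1 - 3 / 4 * ε) * ∑ v ∈ nbrL G u, s.betaR v ≤ (1 + ε) * s.betaL u ∧
      s.betaL u ≤ (1 + 3 / 4 * ε) * ((1 + ε) * ∑ v ∈ nbrL G u, s.betaR v)

/-- The levels are still accurate, `j` rounds after they were formed. The levels on the left stem
from estimates that were one round old at the start of the phase. -/
structure Accurate (G : SimpleGraph (L ⊕ R)) (ε : ℝ) (j : ℕ) (s : State L R) : Prop where
  right : ∀ v, (1 + ε) ^ (s.levR v - 1 - j) < s.betaR v ∧ s.betaR v ≤ (1 + ε) ^ (s.levR v + j)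
  left : ∀ u, (nbrL G u).Nonempty →
    (1 + ε) ^ (s.levL u - 1 - (j + 1)) < (1 + 3 / 4 * ε) * ∑ v ∈ nbrL G u, s.betaR v ∧
      (1 - 3 / 4 * ε) * ∑ v ∈ nbrL G u, s.betaR v ≤ (1 + ε) ^ (s.levL u + (j + 1))

theorem balanced_initial (hε : 0 < ε) : Balanced G C ε 0 (initial G) where
  pos _ := one_pos
  saturated _ := Or.inl (by simp [initial])
  bounded _ := Or.inl (by simp [initial])
  left u _ := by
    simp only [initial]
    have h : (0 : ℝ) ≤ ∑ _v ∈ nbrL G u, (1 : ℝ) := Finset.sum_nonneg fun _ _ => zero_le_one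
    have h' := mul_nonneg hε.le h
    have h'' := mul_nonneg hε.le h'
    constructor <;> linarith

theorem Balanced.regroup {r : ℕ} {s : State L R} (h : Balanced G C ε r s) :
    Balanced G C ε r (regroup ε s) :=
  ⟨h.pos, h.saturated, h.bounded, h.left⟩

theorem Balanced.accurate_regroup (hε : 0 < ε) (hε' : ε ≤ 1 / 4) {r : ℕ} {s : State L R}
    (h : Balanced G C ε r s) : Accurate G ε 0 (Alloc.regroup ε s) where
  right v := by
    have := (level_eq_iff hε (h.pos v) _).1 rfl
    simpa [Alloc.regroup] using this
  left u hu := by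
    have hk : 0 < 1 + ε := by linarith
    have hpos := sum_priorities_pos h.pos hu
    obtain ⟨h1, h2⟩ := h.left u hu
    have hb : 0 < s.betaL u :=
      pos_of_mul_pos_right ((mul_pos (by linarith) hpos).trans_le h1) hk.le
    obtain ⟨h3, h4⟩ := (level_eq_iff hε hb _).1 rfl
    simp only [Alloc.regroup, Nat.cast_zero, zero_add]
    constructor
    · rw [zpow_sub_one₀ hk.ne', mul_inv_lt_iff₀ hk]
      exact h3.trans_le (h2.trans (by linarith))
    · rw [zpow_add_one₀ hk.ne', mul_comm (_ ^ _)]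
      exact h1.trans (by gcongr)

/-- The state after one round with the given samples. -/
noncomputable def nextState (C : R → ℕ) (ε : ℝ) {t : ℕ} (s : State L R)
    (S : Samples (nbrL G) s.levR t) (T : Samples (nbrR G) s.levL t) : State L R where
  betaL u := estimate S s.betaR u
  betaR v := updatePriority ε (s.betaR v)
    (estimate T (fun u => s.betaR v / estimate S s.betaR u) v) (C v)
  levR := s.levR
  levL := s.levL
  lastR := s.betaR

/-- The samples of the left vertices are good for the state `s`. -/
def GoodLeft (ε : ℝ) {t : ℕ} (s : State L R) (S : Samples (nbrL G) s.levR t) : Prop :=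
  ∀ u, |estimate S s.betaR u - ∑ v ∈ nbrL G u, s.betaR v| ≤
    3 / 4 * ε * ∑ v ∈ nbrL G u, s.betaR v

/-- The samples of the right vertices are good for the state `s` and the samples on the left. -/
def GoodRight (ε : ℝ) {t : ℕ} (s : State L R) (S : Samples (nbrL G) s.levR t)
    (T : Samples (nbrR G) s.levL t) : Prop :=
  ∀ v, |estimate T (fun u => s.betaR v / estimate S s.betaR u) v -
      ∑ u ∈ nbrR G v, s.betaR v / estimate S s.betaR u| ≤
    5 / 4 * ε * ∑ u ∈ nbrR G v, s.betaR v / estimate S s.betaR u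

variable {t : ℕ} {s : State L R} {S : Samples (nbrL G) s.levR t} {T : Samples (nbrR G) s.levL t}

omit [Fintype L] in
theorem GoodLeft.bounds (hS : GoodLeft ε s S) (u : L) :
    (1 - 3 / 4 * ε) * ∑ v ∈ nbrL G u, s.betaR v ≤ estimate S s.betaR u ∧
      estimate S s.betaR u ≤ (1 + 3 / 4 * ε) * ∑ v ∈ nbrL G u, s.betaR v := by
  have := abs_le.1 (hS u)
  constructor <;> linarith [this.1, this.2]

omit [Fintype L] in
theorem GoodLeft.pos (hε' : ε ≤ 1 / 4) (hβ : ∀ v, 0 < s.betaR v) (hS : GoodLeft ε s S) {u : L}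
    (hu : (nbrL G u).Nonempty) : 0 < estimate S s.betaR u :=
  (mul_pos (by linarith) (sum_priorities_pos hβ hu)).trans_le (hS.bounds u).1

/-- With good samples, the amounts allocated to the right vertices are estimated well. -/
theorem GoodRight.alloc_bounds (hε : 0 < ε) (hε' : ε ≤ 1 / 4) (hβ : ∀ v, 0 < s.betaR v)
    (hS : GoodLeft ε s S) (hT : GoodRight ε s S T) (v : R) :
    alloc G s.betaR v ≤ (1 + 3 / 4 * ε) / (1 - 5 / 4 * ε) *
        estimate T (fun u => s.betaR v / estimate S s.betaR u) v ∧
      estimate T (fun u => s.betaR v / estimate S s.betaR u) v ≤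
        (1 + 3 / 4 * ε) / (1 - 5 / 4 * ε) * alloc G s.betaR v := by
  set a := estimate T (fun u => s.betaR v / estimate S s.betaR u) v
  set m := ∑ u ∈ nbrR G v, s.betaR v / estimate S s.betaR u with hm
  obtain ⟨h1, h2⟩ := abs_le.1 (hT v)
  have hal : alloc G s.betaR v ≤ (1 + 3 / 4 * ε) * m ∧
      (1 - 3 / 4 * ε) * m ≤ alloc G s.betaR v := by
    unfold alloc
    rw [hm, Finset.mul_sum, Finset.mul_sum]
    constructor <;> refine Finset.sum_le_sum fun u hu => ?_
    all_goals
      have hne : (nbrL G u).Nonempty := ⟨v, mem_nbrL.2 (mem_nbrR.1 hu)⟩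
      have h3 := sum_priorities_pos hβ hne
      have h4 := hS.pos hε' hβ hne
      have h5 := hS.bounds u
      unfold proportional
      rw [mul_div_assoc', div_le_div_iff₀ (by assumption) (by assumption)]
    · have := mul_le_mul_of_nonneg_left h5.2 (hβ v).le
      linarith
    · have := mul_le_mul_of_nonneg_left h5.1 (hβ v).le
      linarith
  have hal0 := alloc_nonneg (G := G) hβ v
  have hm0 : 0 ≤ m := by
    by_contra hneg
    have := mul_neg_of_pos_of_neg (by linarith : 0 < 1 + 3 / 4 * ε) (not_le.1 hneg)
    linarith [hal.1]
  have hd : 0 < 1 - 5 / 4 * ε := by linarith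
  constructor
  · rw [div_mul_eq_mul_div, le_div_iff₀ hd]
    have e1 := mul_le_mul_of_nonneg_right hal.1 hd.le
    have e2 : (1 + 3 / 4 * ε) * ((1 - 5 / 4 * ε) * m) ≤ (1 + 3 / 4 * ε) * a :=
      mul_le_mul_of_nonneg_left (by linarith) (by linarith)
    linarith
  · rw [div_mul_eq_mul_div, le_div_iff₀ hd]
    have e1 : a * (1 - 5 / 4 * ε) ≤ ((1 + 5 / 4 * ε) * m) * (1 - 5 / 4 * ε) :=
      mul_le_mul_of_nonneg_right (by linarith) hd.le
    have e2 : (1 + 3 / 4 * ε) * ((1 - 3 / 4 * ε) * m) ≤ (1 + 3 / 4 * ε) * alloc G s.betaR v :=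
      mul_le_mul_of_nonneg_left hal.2 (by linarith)
    have e3 : 0 ≤ ε ^ 2 * m := by positivity
    linarith

theorem nextState_betaR_bounds (hε : 0 < ε) (hβ : ∀ v, 0 < s.betaR v) (v : R) :
    0 < (nextState C ε s S T).betaR v ∧
      (nextState C ε s S T).betaR v ≤ (1 + ε) * s.betaR v ∧
      s.betaR v ≤ (1 + ε) * (nextState C ε s S T).betaR v :=
  updatePriority_bounds hε (hβ v) _ _

theorem sum_nextState_betaR_bounds (hε : 0 < ε) (hβ : ∀ v, 0 < s.betaR v) (u : L) :
    ∑ v ∈ nbrL G u, (nextState C ε s S T).betaR v ≤ (1 + ε) * ∑ v ∈ nbrL G u, s.betaR v ∧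
      ∑ v ∈ nbrL G u, s.betaR v ≤ (1 + ε) * ∑ v ∈ nbrL G u, (nextState C ε s S T).betaR v := by
  rw [Finset.mul_sum, Finset.mul_sum]
  exact ⟨Finset.sum_le_sum fun v _ => (nextState_betaR_bounds hε hβ v).2.1,
    Finset.sum_le_sum fun v _ => (nextState_betaR_bounds hε hβ v).2.2⟩

theorem Balanced.nextState (hε : 0 < ε) (hε' : ε ≤ 1 / 4) {r : ℕ} (h : Balanced G C ε r s)
    (hS : GoodLeft ε s S) (hT : GoodRight ε s S T) :
    Balanced G C ε (r + 1) (nextState C ε s S T) := by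
  have hk : 0 < 1 + ε := by linarith
  have hpos := fun v => (nextState_betaR_bounds (C := C) (S := S) (T := T) hε h.pos v).1
  have hcases := fun v => updatePriority_cases (A := 1 + 7 * ε) (c := (C v : ℝ)) hε (h.pos v)
    (alloc_nonneg (G := G) hpos v) (Nat.cast_nonneg _)
    (by rw [le_div_iff₀ (by linarith)]; linarith) (sq_mul_ratio_le hε hε')
    (mul_alloc_le G h.pos hpos (fun v => (nextState_betaR_bounds hε h.pos v).2.2) v)
    (mul_alloc_le G hpos h.pos (fun v => (nextState_betaR_bounds hε h.pos v).2.1) v)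
    (hT.alloc_bounds hε hε' h.pos hS v).1 (hT.alloc_bounds hε hε' h.pos hS v).2
  refine ⟨hpos, fun v => ?_, fun v => ?_, fun u hu => ?_⟩
  · rcases (hcases v).1 with ⟨hup, hle⟩ | hle
    · refine (h.saturated v).imp (fun hv => ?_) fun hv => hv.trans (by gcongr)
      rw [pow_succ, ← hv]
      exact hup
    · exact Or.inr hle
  · rcases (hcases v).2 with ⟨hdown, hle⟩ | hle
    · refine (h.bounded v).imp (fun hv => ?_) fun hv => hle.trans hv
      rw [pow_succ, mul_inv, ← hv]
      exact hdown
    · exact Or.inr hle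
  · obtain ⟨h1, h2⟩ := sum_nextState_betaR_bounds (C := C) (S := S) (T := T) hε h.pos u
    obtain ⟨h3, h4⟩ := hS.bounds u
    constructor
    · calc _ ≤ (1 - 3 / 4 * ε) * ((1 + ε) * ∑ v ∈ nbrL G u, s.betaR v) :=
            mul_le_mul_of_nonneg_left h1 (by linarith)
        _ = (1 + ε) * ((1 - 3 / 4 * ε) * ∑ v ∈ nbrL G u, s.betaR v) := by ring
        _ ≤ _ := mul_le_mul_of_nonneg_left h3 hk.le
    · exact h4.trans (mul_le_mul_of_nonneg_left h2 (by linarith))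

theorem Accurate.nextState (hε : 0 < ε) (hε' : ε ≤ 1 / 4) {j : ℕ} (hβ : ∀ v, 0 < s.betaR v)
    (h : Accurate G ε j s) : Accurate G ε (j + 1) (nextState C ε s S T) := by
  have hk : 0 < 1 + ε := by linarith
  refine ⟨fun v => ?_, fun u hu => ?_⟩
  · obtain ⟨-, h1, h2⟩ := nextState_betaR_bounds (C := C) (S := S) (T := T) hε hβ v
    obtain ⟨h3, h4⟩ := h.right v
    change (1 + ε) ^ (s.levR v - 1 - (j + 1 : ℕ)) < _ ∧ _ ≤ (1 + ε) ^ (s.levR v + (j + 1 : ℕ))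
    constructor
    · rw [show s.levR v - 1 - ((j + 1 : ℕ) : ℤ) = (s.levR v - 1 - j) - 1 by push_cast; ring,
        zpow_sub_one₀ hk.ne', mul_inv_lt_iff₀ hk]
      linarith
    · rw [show s.levR v + ((j + 1 : ℕ) : ℤ) = (s.levR v + j) + 1 by push_cast; ring,
        zpow_add_one₀ hk.ne', mul_comm]
      exact h1.trans (by gcongr)
  · obtain ⟨h1, h2⟩ := sum_nextState_betaR_bounds (C := C) (S := S) (T := T) hε hβ u
    obtain ⟨h3, h4⟩ := h.left u hu
    change (1 + ε) ^ (s.levL u - 1 - (((j + 1 : ℕ) : ℤ) + 1)) < _ ∧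
      _ ≤ (1 + ε) ^ (s.levL u + (((j + 1 : ℕ) : ℤ) + 1))
    constructor
    · rw [show s.levL u - 1 - (((j + 1 : ℕ) : ℤ) + 1) = (s.levL u - 1 - (j + 1)) - 1 by
          push_cast; ring, zpow_sub_one₀ hk.ne', mul_inv_lt_iff₀ hk]
      have := mul_le_mul_of_nonneg_left h2 (by linarith : 0 ≤ 1 + 3 / 4 * ε)
      linarith
    · rw [show s.levL u + (((j + 1 : ℕ) : ℤ) + 1) = (s.levL u + (j + 1)) + 1 by
          push_cast; ring, zpow_add_one₀ hk.ne']
      have := mul_le_mul_of_nonneg_left h1 (by linarith : 0 ≤ 1 - 3 / 4 * ε)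
      have := mul_le_mul_of_nonneg_right h4 hk.le
      linarith

omit [Fintype L] in
/-- Within a phase, the priorities in a group differ by a factor of at most `(1 + ε) ^ (2 * B)`. -/
theorem Accurate.betaR_le (hε : 0 < ε) {j B : ℕ} (hjB : j < B)
    (h : Accurate G ε j s) {v v' : R} (hv : s.levR v = s.levR v') :
    s.betaR v ≤ (1 + ε) ^ (2 * B) * s.betaR v' := by
  have hk : 0 < 1 + ε := by linarith
  calc s.betaR v ≤ (1 + ε) ^ (s.levR v + j) := (h.right v).2
    _ = (1 + ε) ^ (2 * j + 1) * (1 + ε) ^ (s.levR v' - 1 - j) := by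
        rw [← zpow_natCast, ← zpow_add₀ hk.ne', hv]
        congr 1
        push_cast
        ring
    _ ≤ (1 + ε) ^ (2 * B) * s.betaR v' :=
        mul_le_mul (pow_le_pow_right₀ (by linarith) (by omega)) (h.right v').1.le
          (by positivity) (by positivity)

omit [Fintype L] in
/-- Within a phase, the estimates on the left differ in each group by a factor that is only
slightly larger than `(1 + ε) ^ (2 * B)`. -/
theorem Accurate.estimate_le (hε : 0 < ε) (hε' : ε ≤ 1 / 4) {j B : ℕ} (hjB : j < B)
    (h : Accurate G ε j s) (hS : GoodLeft ε s S) {u u' : L} (hu : (nbrL G u).Nonempty)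
    (hu' : (nbrL G u').Nonempty) (huu : s.levL u = s.levL u') :
    estimate S s.betaR u ≤ (1 + ε) ^ (2 * B + 1) *
      ((1 + 3 / 4 * ε) / (1 - 3 / 4 * ε)) ^ 2 * estimate S s.betaR u' := by
  have hk : 0 < 1 + ε := by linarith
  have hd : 0 < 1 - 3 / 4 * ε := by linarith
  have hd' : 0 < 1 + 3 / 4 * ε := by linarith
  rw [div_pow, mul_div_assoc', div_mul_eq_mul_div, le_div_iff₀ (pow_pos hd 2)]
  calc estimate S s.betaR u * (1 - 3 / 4 * ε) ^ 2
      ≤ ((1 + 3 / 4 * ε) * ∑ v ∈ nbrL G u, s.betaR v) * (1 - 3 / 4 * ε) ^ 2 :=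
        mul_le_mul_of_nonneg_right (hS.bounds u).2 (by positivity)
    _ = ((1 + 3 / 4 * ε) * (1 - 3 / 4 * ε)) *
          ((1 - 3 / 4 * ε) * ∑ v ∈ nbrL G u, s.betaR v) := by ring
    _ ≤ ((1 + 3 / 4 * ε) * (1 - 3 / 4 * ε)) * (1 + ε) ^ (s.levL u + (j + 1)) :=
        mul_le_mul_of_nonneg_left (h.left u hu).2 (by positivity)
    _ = ((1 + 3 / 4 * ε) * (1 - 3 / 4 * ε)) *
          ((1 + ε) ^ (2 * j + 3) * (1 + ε) ^ (s.levL u' - 1 - (j + 1))) := by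
        rw [← zpow_natCast, ← zpow_add₀ hk.ne', huu]
        congr 2
        push_cast
        ring
    _ ≤ ((1 + 3 / 4 * ε) * (1 - 3 / 4 * ε)) *
          ((1 + ε) ^ (2 * B + 1) * ((1 + 3 / 4 * ε) * ∑ v ∈ nbrL G u', s.betaR v)) := by
        refine mul_le_mul_of_nonneg_left ?_ (by positivity)
        exact mul_le_mul (pow_le_pow_right₀ (by linarith) (by omega)) (h.left u' hu').1.le
          (by positivity) (by positivity)
    _ = (1 + ε) ^ (2 * B + 1) * (1 + 3 / 4 * ε) ^ 2 *
          ((1 - 3 / 4 * ε) * ∑ v ∈ nbrL G u', s.betaR v) := by ring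
    _ ≤ _ := mul_le_mul_of_nonneg_left (hS.bounds u').1 (by positivity)

end Round

end Alloc

/-! ### The failure probability -/

namespace Alloc

section Probability

/-- If `p` avoids `A` with probability at most `q₁`, and the second step fails with probability
at most `q₂` from each point of `A`, then both steps fail with probability at most `q₁ + q₂`. -/
theorem toOuterMeasure_bind_le {α β : Type*} (p : PMF α) (f : α → PMF β) (A : Set α) (s : Set β)
    {q₁ q₂ : ENNReal} (h₁ : p.toOuterMeasure Aᶜ ≤ q₁)
    (h₂ : ∀ a ∈ A, (f a).toOuterMeasure s ≤ q₂) :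
    (p.bind f).toOuterMeasure s ≤ q₁ + q₂ := by
  rw [PMF.toOuterMeasure_bind_apply]
  calc ∑' a, p a * (f a).toOuterMeasure s ≤ ∑' a, (Aᶜ.indicator p a + p a * q₂) := by
        refine ENNReal.tsum_le_tsum fun a => ?_
        by_cases ha : a ∈ A
        · rw [Set.indicator_of_notMem (by simpa using ha), zero_add]
          gcongr
          exact h₂ a ha
        · rw [Set.indicator_of_mem (by simpa using ha)]
          refine le_add_right (mul_le_of_le_one_right' ?_)
          exact ((f a).toOuterMeasure.mono (Set.subset_univ s)).trans
            ((PMF.toOuterMeasure_apply_eq_one_iff _ _).2 (Set.subset_univ _)).le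
    _ = p.toOuterMeasure Aᶜ + q₂ := by
        rw [ENNReal.tsum_add, ENNReal.tsum_mul_right, PMF.tsum_coe, one_mul,
          PMF.toOuterMeasure_apply]
    _ ≤ q₁ + q₂ := by gcongr

theorem ofReal_one_sub_le_toOuterMeasure {α : Type*} (p : PMF α) (s : Set α) {q : ℝ} (hq : 0 ≤ q)
    (h : p.toOuterMeasure sᶜ ≤ ENNReal.ofReal q) :
    ENNReal.ofReal (1 - q) ≤ p.toOuterMeasure s := by
  have h1 : (1 : ENNReal) ≤ p.toOuterMeasure s + p.toOuterMeasure sᶜ := by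
    rw [← (PMF.toOuterMeasure_apply_eq_one_iff p Set.univ).2 (Set.subset_univ _),
      ← Set.union_compl_self s]
    exact MeasureTheory.measure_union_le _ _
  calc ENNReal.ofReal (1 - q) = 1 - ENNReal.ofReal q := by
        rw [ENNReal.ofReal_sub _ hq, ENNReal.ofReal_one]
    _ ≤ p.toOuterMeasure s := by
        refine tsub_le_iff_right.2 (h1.trans ?_)
        gcongr

variable {L R : Type*} [Fintype L] [Fintype R] {G : SimpleGraph (L ⊕ R)} {C : R → ℕ} {ε : ℝ}

/-- A bound for the exponents of all the sample sums, from the size of the samples. -/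
theorem exponent_bounds (hε : 0 < ε) (hε' : ε ≤ 1 / 4) {B t : ℕ} {ℓ : ℝ} (hℓ : 0 ≤ ℓ)
    (ht : (1 + ε) ^ (2 * B) * (ε ^ 5)⁻¹ * ℓ ≤ t) :
    9 / 64 * (ε ^ 3)⁻¹ * ℓ ≤ (3 / 4 * ε) ^ 2 * t / (4 * (1 + ε) ^ (2 * B)) ∧
      9 / 64 * (ε ^ 3)⁻¹ * ℓ ≤ (5 / 4 * ε) ^ 2 * t /
        (4 * ((1 + ε) ^ (2 * B + 1) * ((1 + 3 / 4 * ε) / (1 - 3 / 4 * ε)) ^ 2)) := by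
  have hk : 0 < (1 + ε) ^ (2 * B) := by positivity
  have hd : 0 < 1 - 3 / 4 * ε := by linarith
  have hd' : 0 < 1 + 3 / 4 * ε := by linarith
  have h0 : (ε ^ 3)⁻¹ = ε ^ 2 * (ε ^ 5)⁻¹ := by field_simp
  have hy : 0 ≤ ε ^ 2 * (ε ^ 5)⁻¹ * ℓ := by positivity
  have h1 := mul_le_mul_of_nonneg_left ht (sq_nonneg ε)
  constructor
  · rw [le_div_iff₀ (by positivity), h0]
    linarith
  · -- The constant `25 / 9` is what remains of `(5 / 4) ^ 2 / 4` after division by `9 / 64`.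
    have h2 : (1 + ε) * ((1 + 3 / 4 * ε) / (1 - 3 / 4 * ε)) ^ 2 ≤ 25 / 9 := by
      have e1 : (1 + 3 / 4 * ε) / (1 - 3 / 4 * ε) ≤ 19 / 13 := by
        rw [div_le_div_iff₀ hd (by norm_num)]
        linarith
      have e2 : ((1 + 3 / 4 * ε) / (1 - 3 / 4 * ε)) ^ 2 ≤ (19 / 13) ^ 2 :=
        pow_le_pow_left₀ (by positivity) e1 2
      calc _ ≤ (5 / 4) * (19 / 13 : ℝ) ^ 2 :=
            mul_le_mul (by linarith) e2 (by positivity) (by norm_num)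
        _ ≤ 25 / 9 := by norm_num
    rw [le_div_iff₀ (by positivity), h0, pow_succ]
    set ρ := ((1 + 3 / 4 * ε) / (1 - 3 / 4 * ε)) ^ 2
    calc 9 / 64 * (ε ^ 2 * (ε ^ 5)⁻¹) * ℓ * (4 * ((1 + ε) ^ (2 * B) * (1 + ε) * ρ))
        = 9 / 16 * ((ε ^ 2 * (ε ^ 5)⁻¹ * ℓ) * (1 + ε) ^ (2 * B)) * ((1 + ε) * ρ) := by ring
      _ ≤ 9 / 16 * ((ε ^ 2 * (ε ^ 5)⁻¹ * ℓ) * (1 + ε) ^ (2 * B)) * (25 / 9) :=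
          mul_le_mul_of_nonneg_left h2 (by positivity)
      _ ≤ _ := by linarith

/-- The failure probabilities of all the groups of a round add up to at most `(4 ε / n) ^ 6`. -/
theorem sq_mul_exp_le (hε : 0 < ε) (hε' : ε ≤ 1 / 4) {n : ℕ} (hn : 2 ≤ n) :
    (n : ℝ) ^ 2 * Real.exp (-(9 / 64 * (ε ^ 3)⁻¹ * Real.log n)) ≤ (4 * ε / n) ^ 6 := by
  have hn0 : (0 : ℝ) < n := by positivity
  set ℓ := Real.log n with hℓ
  have hnℓ : (n : ℝ) = Real.exp ℓ := (Real.exp_log hn0).symm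
  have hℓ1 : 1 / 2 ≤ ℓ := by
    have h2 : Real.log 2 ≤ ℓ := Real.log_le_log (by norm_num) (by exact_mod_cast hn)
    linarith [Real.log_two_gt_d9]
  -- In terms of `z ≥ 1`, the claim is `z ^ 2 ≤ n ^ (9 * z - 8)`, which follows from `n ≥ 2`.
  set z := ((4 * ε) ^ 3)⁻¹ with hz
  have hz1 : 1 ≤ z := by
    rw [hz]
    exact (one_le_inv₀ (by positivity)).2 (pow_le_one₀ (by positivity) (by linarith))
  have hzε : 9 / 64 * (ε ^ 3)⁻¹ = 9 * z := by
    rw [hz, mul_pow, mul_inv]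
    ring
  have h1 : z ^ 2 ≤ Real.exp ((9 * z - 8) * ℓ) := by
    have e1 : z ≤ Real.exp (z - 1) := by linarith [Real.add_one_le_exp (z - 1)]
    calc z ^ 2 ≤ Real.exp (z - 1) ^ 2 := pow_le_pow_left₀ (by linarith) e1 2
      _ = Real.exp (2 * (z - 1)) := by rw [← Real.exp_nat_mul]; norm_num
      _ ≤ _ := Real.exp_le_exp.2 (by nlinarith)
  have h2 : (4 * ε) ^ 6 = (z ^ 2)⁻¹ := by
    rw [hz, inv_pow, inv_inv]
    ring
  rw [hzε, div_pow, h2, le_div_iff₀ (by positivity), hnℓ, ← Real.exp_nat_mul, ← Real.exp_nat_mul,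
    ← Real.exp_add, ← Real.exp_add, le_inv_comm₀ (Real.exp_pos _) (by positivity), ← Real.exp_neg]
  refine h1.trans (Real.exp_le_exp.2 (le_of_eq ?_))
  push_cast
  ring

theorem toOuterMeasure_not_goodLeft_le (hε : 0 < ε) (hε' : ε ≤ 1 / 4) {B t j : ℕ} (ht : 0 < t)
    (hjB : j < B) {s : State L R} (hβ : ∀ v, 0 < s.betaR v) (h : Accurate G ε j s) :
    (PMF.uniformOfFintype (Samples (nbrL G) s.levR t)).toOuterMeasure {S | GoodLeft ε s S}ᶜ ≤
      ENNReal.ofReal (Fintype.card L * Fintype.card R *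
        (2 * Real.exp (-((3 / 4 * ε) ^ 2 * t / (4 * (1 + ε) ^ (2 * B)))))) :=
  toOuterMeasure_estimate_le ht (fun _ => s.betaR) (fun _ v _ => hβ v)
    (fun _ _ _ _ _ hv => h.betaR_le hε hjB hv) (by positivity) (by linarith)

theorem toOuterMeasure_not_goodRight_le (hε : 0 < ε) (hε' : ε ≤ 1 / 4) {B t j : ℕ} (ht : 0 < t)
    (hjB : j < B) {s : State L R} (hβ : ∀ v, 0 < s.betaR v) (h : Accurate G ε j s)
    {S : Samples (nbrL G) s.levR t} (hS : GoodLeft ε s S) :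
    (PMF.uniformOfFintype (Samples (nbrR G) s.levL t)).toOuterMeasure {T | GoodRight ε s S T}ᶜ ≤
      ENNReal.ofReal (Fintype.card R * Fintype.card L *
        (2 * Real.exp (-((5 / 4 * ε) ^ 2 * t /
          (4 * ((1 + ε) ^ (2 * B + 1) * ((1 + 3 / 4 * ε) / (1 - 3 / 4 * ε)) ^ 2)))))) := by
  have hne : ∀ v, ∀ u ∈ nbrR G v, (nbrL G u).Nonempty := fun v u hu =>
    ⟨v, mem_nbrL.2 (mem_nbrR.1 hu)⟩
  refine toOuterMeasure_estimate_le ht (fun v u => s.betaR v / estimate S s.betaR u)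
    (fun v u hu => div_pos (hβ v) (hS.pos hε' hβ (hne v u hu)))
    (fun v u hu u' hu' huu => ?_) (by positivity) (by linarith)
  have h1 := hS.pos hε' hβ (hne v u hu)
  have h2 := hS.pos hε' hβ (hne v u' hu')
  rw [mul_div_assoc', div_le_div_iff₀ h1 h2]
  have := mul_le_mul_of_nonneg_left
    (h.estimate_le hε hε' hjB hS (hne v u' hu') (hne v u hu) huu.symm) (hβ v).le
  linarith

/-- One round preserves the invariant, unless its samples are bad. -/
theorem toOuterMeasure_oneRound_le (hε : 0 < ε) (hε' : ε ≤ 1 / 4) {n : ℕ} (hn2 : 2 ≤ n)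
    (hn : n = Fintype.card L + Fintype.card R) {B t j r : ℕ}
    (ht : (1 + ε) ^ (2 * B) * (ε ^ 5)⁻¹ * Real.log n ≤ t) (hjB : j < B) {s : State L R}
    (hs : Balanced G C ε r s) (h : Accurate G ε j s) :
    (oneRound G C ε t s).toOuterMeasure
        {s' | Balanced G C ε (r + 1) s' ∧ Accurate G ε (j + 1) s'}ᶜ ≤
      ENNReal.ofReal ((4 * ε / n) ^ 6) := by
  have hlog : 0 < Real.log n := Real.log_pos (by exact_mod_cast hn2)
  have ht0 : 0 < t := by
    have : (0 : ℝ) < t := lt_of_lt_of_le (by positivity) ht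
    exact_mod_cast this
  obtain ⟨hL, hR⟩ := exponent_bounds hε hε' hlog.le ht
  set E := 9 / 64 * (ε ^ 3)⁻¹ * Real.log n with hE
  have hprob : ENNReal.ofReal (Fintype.card L * Fintype.card R * (2 * Real.exp (-E))) +
      ENNReal.ofReal (Fintype.card L * Fintype.card R * (2 * Real.exp (-E))) ≤
      ENNReal.ofReal ((4 * ε / n) ^ 6) := by
    rw [← ENNReal.ofReal_add (by positivity) (by positivity)]
    refine ENNReal.ofReal_le_ofReal (le_trans ?_ (sq_mul_exp_le hε hε' hn2))
    have h4 : (4 : ℝ) * (Fintype.card L * Fintype.card R) ≤ (n : ℝ) ^ 2 := by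
      rw [hn]
      push_cast
      nlinarith [sq_nonneg ((Fintype.card L : ℝ) - Fintype.card R)]
    have := mul_le_mul_of_nonneg_right h4 (Real.exp_pos (-E)).le
    linarith
  refine le_trans ?_ hprob
  unfold oneRound
  refine toOuterMeasure_bind_le _ _ {S | GoodLeft ε s S} _ ?_ fun S hS => ?_
  · refine (toOuterMeasure_not_goodLeft_le hε hε' ht0 hjB hs.pos h).trans ?_
    gcongr
  · rw [PMF.toOuterMeasure_map_apply]
    calc _ ≤ (PMF.uniformOfFintype (Samples (nbrR G) s.levL t)).toOuterMeasure
            {T | GoodRight ε s S T}ᶜ := by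
          refine MeasureTheory.measure_mono fun T hT hgood => hT ?_
          exact ⟨hs.nextState hε hε' hS hgood, h.nextState hε hε' hs.pos⟩
      _ ≤ _ := toOuterMeasure_not_goodRight_le hε hε' ht0 hjB hs.pos h hS
      _ ≤ _ := by
          rw [mul_comm (Fintype.card R : ℝ)]
          gcongr

/-- With high probability, the invariant holds after `r` rounds. The accuracy of the levels is
not needed at the end of a phase, where they are replaced. -/
theorem toOuterMeasure_run_le (hε : 0 < ε) (hε' : ε ≤ 1 / 4) {n : ℕ} (hn2 : 2 ≤ n)
    (hn : n = Fintype.card L + Fintype.card R) {B t : ℕ} (hB : 1 ≤ B)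
    (ht : (1 + ε) ^ (2 * B) * (ε ^ 5)⁻¹ * Real.log n ≤ t) (r : ℕ) :
    (run G C ε B t r).toOuterMeasure
        {s | Balanced G C ε r s ∧ (r % B ≠ 0 → Accurate G ε (r % B) s)}ᶜ ≤
      ENNReal.ofReal (r * (4 * ε / n) ^ 6) := by
  induction r with
  | zero =>
    rw [run, PMF.toOuterMeasure_pure_apply, if_neg]
    · exact zero_le
    · exact fun h => h ⟨balanced_initial hε, fun h => absurd (Nat.zero_mod B) h⟩
  | succ r ih =>
    rw [run, Nat.cast_succ, add_mul, one_mul, ENNReal.ofReal_add (by positivity) (by positivity)]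
    refine toOuterMeasure_bind_le _ _ _ _ ih fun s hs => ?_
    set s' := if r % B = 0 then regroup ε s else s with hs'
    have hbal : Balanced G C ε r s' := by
      rw [hs']
      split_ifs
      · exact hs.1.regroup
      · exact hs.1
    have hacc : Accurate G ε (r % B) s' := by
      rw [hs']
      split_ifs with h
      · rw [h]
        exact hs.1.accurate_regroup hε hε'
      · exact hs.2 h
    refine le_trans (MeasureTheory.measure_mono ?_)
      (toOuterMeasure_oneRound_le hε hε' hn2 hn ht (Nat.mod_lt r hB) hbal hacc)
    refine Set.compl_subset_compl.2 fun s'' h => ⟨h.1, fun hmod => ?_⟩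
    have hmod' : (r + 1) % B = r % B + 1 := by
      have h1 := Nat.mod_lt r hB
      rw [← Nat.mod_add_mod] at hmod ⊢
      refine Nat.mod_eq_of_lt (lt_of_le_of_ne h1 fun heq => hmod ?_)
      rw [heq, Nat.mod_self]
    rw [hmod']
    exact h.2

/-- The invariant gives the approximation guarantee, once `(1 + ε) ^ r` is large against the
arboricity. -/
theorem Balanced.isApproxFractionalAllocation (hC : ∀ v, 1 ≤ C v) (hε : 0 < ε) (hε' : ε ≤ 1 / 4)
    {r : ℕ} {s : State L R} (h : Balanced G C ε r s) (ha : 1 ≤ arboricity G)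
    (hr : 4 * (arboricity G : ℝ) / ε ≤ (1 + ε) ^ r) :
    IsApproxFractionalAllocation G C (2 + 16 * ε) (scaled G C s.betaR) := by
  classical
  set K := (1 + ε) ^ r with hK
  have ha' : (1 : ℝ) ≤ arboricity G := by exact_mod_cast ha
  rw [div_le_iff₀ hε] at hr
  have hK1 : 1 < K := by nlinarith
  have hK0 : 0 < K := by linarith
  refine isApproxFractionalAllocation_scaled hC h.pos
    (T := Finset.univ.filter fun v => s.betaR v = K)
    (Z := Finset.univ.filter fun v => s.betaR v = K⁻¹) (q := K⁻¹ * K⁻¹) (A := 1 + 7 * ε)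
    (η := ε / 64) ?_ (by positivity) (by linarith) ?_ ?_ ?_ ?_ (by linarith) ?_
  · refine Finset.disjoint_filter.2 fun v _ h1 h2 => ?_
    have := inv_lt_one_of_one_lt₀ hK1
    linarith
  · intro v hv v' hv'
    rw [(Finset.mem_filter.1 hv).2, (Finset.mem_filter.1 hv').2, inv_mul_cancel_right₀ hK0.ne']
  · exact fun v hv => (h.saturated v).resolve_left (by simpa using hv)
  · exact fun v hv => (h.bounded v).resolve_left (by simpa using hv)
  · -- `K` is at least `4 λ / ε` and at least `16`.
    have h1 : K⁻¹ ≤ 1 / 16 := by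
      rw [inv_le_comm₀ hK0 (by norm_num)]
      nlinarith
    have h2 : K⁻¹ * arboricity G ≤ ε / 4 := by
      rw [inv_mul_le_iff₀ hK0]
      linarith
    calc K⁻¹ * K⁻¹ * arboricity G = K⁻¹ * (K⁻¹ * arboricity G) := by ring
      _ ≤ 1 / 16 * (ε / 4) := mul_le_mul h1 h2 (by positivity) (by norm_num)
      _ = ε / 64 := by ring
  · nlinarith

/-- The last round does not change the priorities that the output is computed from. -/
theorem toOuterMeasure_run_succ_le (B t r : ℕ) (P : (R → ℝ) → Prop) :
    (run G C ε B t (r + 1)).toOuterMeasure {s | P s.lastR}ᶜ ≤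
      (run G C ε B t r).toOuterMeasure {s | P s.betaR}ᶜ := by
  rw [run, ← add_zero ((run G C ε B t r).toOuterMeasure _)]
  refine toOuterMeasure_bind_le _ _ {s | P s.betaR} _ le_rfl fun s hs => ?_
  unfold oneRound
  refine (toOuterMeasure_bind_le _ _ Set.univ _ (q₁ := 0) (q₂ := 0) (by simp)
    fun S _ => ?_).trans (by simp)
  rw [PMF.toOuterMeasure_map_apply]
  refine le_of_eq (MeasureTheory.measure_mono_null (t := ∅) (fun T hT => hT ?_) (by simp))
  change P (State.betaR _)
  split_ifs
  · exact hs
  · exact hs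

theorem isApproxFractionalAllocation_of_edgeless
    (hG : ∀ u v, ¬ G.Adj (Sum.inl u) (Sum.inr v)) (C : R → ℕ) (α : ℝ) (x : L → R → ℝ) :
    IsApproxFractionalAllocation G C α x := by
  have hL : ∀ u, nbrL G u = ∅ := fun u =>
    Finset.eq_empty_of_forall_notMem fun v hv => hG u v (mem_nbrL.1 hv)
  have hR : ∀ v, nbrR G v = ∅ := fun v =>
    Finset.eq_empty_of_forall_notMem fun u hu => hG u v (mem_nbrR.1 hu)
  exact ⟨⟨fun u v h => absurd h (hG u v), by simp [hL], by simp [hR]⟩,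
    fun y _ => by simp [weight, hL]⟩

end Probability

end Alloc

theorem mainTheorem7 {L R : Type*} [Fintype L] [Fintype R]
    (G : SimpleGraph (L ⊕ R)) (hG : G ≤ completeBipartiteGraph L R)
    (C : R → ℕ) (hC : ∀ v, 1 ≤ C v)
    (ε : ℝ) (hε : 0 < ε) (hε' : ε ≤ 1 / 4)
    (n : ℕ) (hn : n = Fintype.card L + Fintype.card R)
    (B : ℕ) (hB : 1 ≤ B)
    (t : ℕ) (ht : (1 + ε) ^ (2 * B) * (ε ^ 5)⁻¹ * Real.log n ≤ (t : ℝ))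
    (τ : ℕ) (hτ : Real.logb (1 + ε) (4 * (arboricity G : ℝ) / ε) + 1 ≤ (τ : ℝ)) :
    ENNReal.ofReal (1 - (τ : ℝ) * (4 * ε / (n : ℝ)) ^ 6) ≤
      (Alloc.sampledAllocation G C ε B t τ).toOuterMeasure
        {x | Alloc.IsApproxFractionalAllocation G C (2 + 16 * ε) x} := by
  refine Alloc.ofReal_one_sub_le_toOuterMeasure _ _ (by positivity) ?_
  -- Without edges, `n` and `t` may be too small for the sampling bounds, but nothing is sampled.
  by_cases hadj : ∀ u v, ¬ G.Adj (Sum.inl u) (Sum.inr v)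
  · have huniv : {x | Alloc.IsApproxFractionalAllocation G C (2 + 16 * ε) x} = Set.univ :=
      Set.eq_univ_of_forall (Alloc.isApproxFractionalAllocation_of_edgeless hadj C _)
    rw [huniv]
    simp
  push Not at hadj
  obtain ⟨u, v, huv⟩ := hadj
  have ha := arboricity_pos huv
  have ha' : (1 : ℝ) ≤ arboricity G := by exact_mod_cast ha
  have hn2 : 2 ≤ n := by
    have := Fintype.card_pos_iff.2 ⟨u⟩
    have := Fintype.card_pos_iff.2 ⟨v⟩
    omega
  have hpos : 0 < 4 * (arboricity G : ℝ) / ε := by positivity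
  have hlog : 0 ≤ Real.logb (1 + ε) (4 * (arboricity G : ℝ) / ε) := by
    refine Real.logb_nonneg (by linarith) ?_
    rw [le_div_iff₀ hε]
    linarith
  obtain ⟨r, rfl⟩ : ∃ r, τ = r + 1 := Nat.exists_eq_succ_of_ne_zero (by
    rintro rfl
    norm_num at hτ
    linarith)
  have hr : 4 * (arboricity G : ℝ) / ε ≤ (1 + ε) ^ r := by
    rw [← Real.rpow_natCast, ← Real.logb_le_iff_le_rpow (by linarith) hpos]
    push_cast at hτ
    linarith
  unfold Alloc.sampledAllocation
  rw [PMF.toOuterMeasure_map_apply]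
  calc _ ≤ _ := Alloc.toOuterMeasure_run_succ_le B t r fun β =>
          Alloc.IsApproxFractionalAllocation G C (2 + 16 * ε) (Alloc.scaled G C β)
    _ ≤ _ := MeasureTheory.measure_mono (Set.compl_subset_compl.2 fun s hs =>
          hs.1.isApproxFractionalAllocation hC hε hε' ha hr)
    _ ≤ _ := Alloc.toOuterMeasure_run_le hε hε' hn2 hn hB ht r
    _ ≤ _ := ENNReal.ofReal_le_ofReal (by push_cast; gcongr; linarith)
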